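/- Conventions. For Hilbert spaces $\mathcal H,\mathcal K$ let $\mathbb B(\mathcal H,\mathcal K)$ be the bounded operators, $\mathbb B(\mathcal H,\mathcal K)_*$ its predual (the norm closure of the span of the vector functionals $x\mapsto\langle\eta,x\xi\rangle$), $\mathbb K(\mathcal H,\mathcal K)$ the compact operators, and let $[S]$ denote the closed linear span of a set $S$ of bounded operators. A $W^*$-category is a $C^*$-category whose morphism spaces are dual Banach spaces. A concrete monoidal $W^*$-category is a monoidal $W^*$-category $\mathcal C$ (with normal, bilinear, $*$-preserving tensor bifunctor) together with a normal strong monoidal $*$-functor $\mathrm{For}$, with unitary structure maps, to the category of Hilbert spaces with the Hilbert space tensor product. The Hilbert spaces underlying objects $H,K,L$ are denoted $\mathcal H,\mathcal K,\mathcal L$; $\mathcal H\otimes\mathcal K$ is identified with the Hilbert space underlying $H\otimes K$, and morphisms are identified with the underlying bounded operators. A braiding $c=(c_{H,K}:H\otimes K\to K\otimes H)$ on $\mathcal C$ is *regular* if it is unitary and $$[(\mathrm{id}\otimes\omega)(c_{H,K})\mid\omega\in\mathbb B(\mathcal K,\mathcal H)_*]=\mathbb K(\mathcal H,\mathcal K)\qquad\text{for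 all }H,K\in\mathcal C .$$ A *multiplicative unitary* in $\mathcal C$ is a unitary morphism $F\in\mathrm{End}_{\mathcal C}(L\otimes L)$ with $$F_{23}F_{12}=F_{12}\,(c_{L,L}^{-1})_{12}\,F_{23}\,(c_{L,L})_{12}\,F_{23}.$$ It is *regular* if $[(\mathrm{id}\otimes\omega)(c_{L,L}^{-1}F)\mid\omega\in\mathbb B(\mathcal L)_*]=\mathbb K(\mathcal L)$. Put $\hat F:=c_{L,L}^{-1}F^*c_{L,L}$. For $X\in\mathrm{End}_{\mathcal C}(H\otimes K)$ put $\hat A(X):=[(\mathrm{id}\otimes\omega)(X)\mid\omega\in\mathbb B(\mathcal K)_*]\subseteq\mathbb B(\mathcal H)$. For closed subspaces $A_i\subseteq\mathbb B(\mathcal H_i)$ and $a\in A_1$, $b\in A_2$ write $$a\boxtimes\mathrm{id}:=c_{H_2,H_1}(\mathrm{id}_{\mathcal H_2}\otimes a)c_{H_2,H_1}^{-1},\qquad \mathrm{id}\boxtimes b:=\mathrm{id}_{\mathcal H_1}\otimes b,\qquad A_1\boxtimes A_2:=[(A_1\boxtimes\mathrm{id})(\mathrm{id}\boxtimes A_2)]\subseteq\mathbb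 B(\mathcal H_1\otimes\mathcal H_2).$$ **Theorem.** Let $\mathcal C$ be a concrete monoidal $W^*$-category with a regular braiding $c$, let $L\in\mathcal C$, and let $F\in\mathrm{End}_{\mathcal C}(L\otimes L)$ be a regular multiplicative unitary. Then $\hat A(F),\hat A(\hat F)\subseteq\mathbb B(\mathcal L)$ and $\hat A(F)\boxtimes\hat A(\hat F)\subseteq\mathbb B(\mathcal L\otimes\mathcal L)$ are non-degenerate $C^*$-algebras, and 1. $F$ is a multiplier of $\hat A(F)\boxtimes\hat A(\hat F)$, i.e. $F\cdot x$ and $x\cdot F$ lie in $\hat A(F)\boxtimes\hat A(\hat F)$ for all $x\in\hat A(F)\boxtimes\hat A(\hat F)$; 2. $[(\hat A(F)\boxtimes\mathrm{id}_{\mathcal L})\,F\,(\mathrm{id}_{\mathcal L}\boxtimes\hat A(\hat F))]=\hat A(F)\boxtimes\hat A(\hat F)$. -/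

import Mathlib

open CategoryTheory MonoidalCategory
open scoped TensorProduct InnerProductSpace

universe u v w

noncomputable section

/-! ### C*-categories, W*-categories, monoidal W*-categories -/

/-- A C*-category: the morphism spaces are complex Banach spaces with bilinear submultiplicative
composition, and there is an isometric conjugate-linear involution `f ↦ f*`, contravariant for the
composition, which satisfies the C*-identity. Recall that `f ≫ g` is `g ∘ f`. -/
class CStarCategory (C : Type u) [Category.{v} C] where
  [homNormedAddCommGroup : ∀ X Y : C, NormedAddCommGroup (X ⟶ Y)]
  [homNormedSpace : ∀ X Y : C, NormedSpace ℂ (X ⟶ Y)]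
  [homComplete : ∀ X Y : C, CompleteSpace (X ⟶ Y)]
  add_comp : ∀ {X Y Z : C} (f f' : X ⟶ Y) (g : Y ⟶ Z), (f + f') ≫ g = f ≫ g + f' ≫ g
  comp_add : ∀ {X Y Z : C} (f : X ⟶ Y) (g g' : Y ⟶ Z), f ≫ (g + g') = f ≫ g + f ≫ g'
  smul_comp : ∀ {X Y Z : C} (a : ℂ) (f : X ⟶ Y) (g : Y ⟶ Z), (a • f) ≫ g = a • (f ≫ g)
  comp_smul : ∀ {X Y Z : C} (a : ℂ) (f : X ⟶ Y) (g : Y ⟶ Z), f ≫ (a • g) = a • (f ≫ g)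
  norm_comp_le : ∀ {X Y Z : C} (f : X ⟶ Y) (g : Y ⟶ Z), ‖f ≫ g‖ ≤ ‖g‖ * ‖f‖
  /-- The involution. -/
  dag : ∀ {X Y : C}, (X ⟶ Y) → (Y ⟶ X)
  dag_dag : ∀ {X Y : C} (f : X ⟶ Y), dag (dag f) = f
  dag_add : ∀ {X Y : C} (f g : X ⟶ Y), dag (f + g) = dag f + dag g
  dag_smul : ∀ {X Y : C} (a : ℂ) (f : X ⟶ Y), dag (a • f) = (starRingEnd ℂ a) • dag f
  dag_comp : ∀ {X Y Z : C} (f : X ⟶ Y) (g : Y ⟶ Z), dag (f ≫ g) = dag g ≫ dag f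
  norm_dag : ∀ {X Y : C} (f : X ⟶ Y), ‖dag f‖ = ‖f‖
  norm_comp_dag : ∀ {X Y : C} (f : X ⟶ Y), ‖f ≫ dag f‖ = ‖f‖ ^ 2

attribute [instance] CStarCategory.homNormedAddCommGroup CStarCategory.homNormedSpace
  CStarCategory.homComplete

open CStarCategory

/-- Unitary morphisms of a C*-category. -/
def IsUnitaryHom {C : Type u} [Category.{v} C] [CStarCategory C] {X Y : C} (f : X ⟶ Y) : Prop :=
  f ≫ dag f = 𝟙 X ∧ dag f ≫ f = 𝟙 Y

/-- A predual of a Banach space `E`, realised (as every predual can be) as a closed subspace `P` of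
the dual of `E`: the canonical map from `E` to the dual of `P` is isometric and surjective. -/
def IsPredual {E : Type*} [NormedAddCommGroup E] [NormedSpace ℂ E]
    (P : Submodule ℂ (StrongDual ℂ E)) : Prop :=
  IsClosed (P : Set (StrongDual ℂ E)) ∧
    (∀ x : E, IsLUB {r : ℝ | ∃ ω ∈ P, ‖ω‖ ≤ 1 ∧ r = ‖ω x‖} ‖x‖) ∧
    ∀ φ : P →L[ℂ] ℂ, ∃ x : E, ∀ ω : P, φ ω = ω.1 x

/-- The locally convex topology on `E` induced by the functionals in `P`. -/
@[reducible]
def ultraweakTopology {E : Type*} [NormedAddCommGroup E] [NormedSpace ℂ E]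
    (P : Submodule ℂ (StrongDual ℂ E)) : TopologicalSpace E :=
  TopologicalSpace.induced (fun (x : E) (ω : P) => ω.1 x) Pi.topologicalSpace

/-- Continuity with respect to the ultraweak topologies given by `P` and `Q`. -/
def IsNormalMap {E E' : Type*} [NormedAddCommGroup E] [NormedSpace ℂ E]
    [NormedAddCommGroup E'] [NormedSpace ℂ E'] (P : Submodule ℂ (StrongDual ℂ E))
    (Q : Submodule ℂ (StrongDual ℂ E')) (f : E → E') : Prop :=
  @Continuous E E' (ultraweakTopology P) (ultraweakTopology Q) f

/-- A W*-category: a C*-category whose morphism spaces have preduals. -/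
class WStarCategory (C : Type u) [Category.{v} C] [CStarCategory C] where
  predual : ∀ X Y : C, Submodule ℂ (StrongDual ℂ (X ⟶ Y))
  isPredual : ∀ X Y : C, IsPredual (predual X Y)

/-- A monoidal W*-category: a W*-category with a monoidal structure whose tensor product is a
normal bifunctor (bilinear, *-preserving, and ultraweakly continuous in each variable). -/
class MonoidalWStarCategory (C : Type u) [Category.{v} C] [CStarCategory C] [WStarCategory C]
    [MonoidalCategory C] : Prop where
  add_tensor : ∀ {X X' Y Y' : C} (f f' : X ⟶ X') (g : Y ⟶ Y'),
    (f + f') ⊗ₘ g = f ⊗ₘ g + f' ⊗ₘ g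
  tensor_add : ∀ {X X' Y Y' : C} (f : X ⟶ X') (g g' : Y ⟶ Y'),
    f ⊗ₘ (g + g') = f ⊗ₘ g + f ⊗ₘ g'
  smul_tensor : ∀ {X X' Y Y' : C} (a : ℂ) (f : X ⟶ X') (g : Y ⟶ Y'),
    (a • f) ⊗ₘ g = a • (f ⊗ₘ g)
  tensor_smul : ∀ {X X' Y Y' : C} (a : ℂ) (f : X ⟶ X') (g : Y ⟶ Y'),
    f ⊗ₘ (a • g) = a • (f ⊗ₘ g)
  dag_tensor : ∀ {X X' Y Y' : C} (f : X ⟶ X') (g : Y ⟶ Y'), dag (f ⊗ₘ g) = dag f ⊗ₘ dag g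
  normal_left : ∀ {X X' Y Y' : C} (g : Y ⟶ Y'),
    IsNormalMap (WStarCategory.predual X X') (WStarCategory.predual (X ⊗ Y) (X' ⊗ Y'))
      (fun f => f ⊗ₘ g)
  normal_right : ∀ {X X' Y Y' : C} (f : X ⟶ X'),
    IsNormalMap (WStarCategory.predual Y Y') (WStarCategory.predual (X ⊗ Y) (X' ⊗ Y'))
      (fun g => f ⊗ₘ g)

/-! ### Hilbert spaces -/

/-- The objects of the category of Hilbert spaces and bounded linear maps. -/
structure HilbSp : Type (w + 1) where
  carrier : Type w
  [normedAddCommGroup : NormedAddCommGroup carrier]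
  [innerProductSpace : InnerProductSpace ℂ carrier]
  [completeSpace : CompleteSpace carrier]

attribute [instance] HilbSp.normedAddCommGroup HilbSp.innerProductSpace HilbSp.completeSpace

instance : Category.{w} HilbSp.{w} where
  Hom H K := H.carrier →L[ℂ] K.carrier
  id H := ContinuousLinearMap.id ℂ H.carrier
  comp f g := ContinuousLinearMap.comp g f

/-- A morphism of Hilbert spaces as a bounded operator. -/
def HilbSp.toCLM {H K : HilbSp.{w}} (f : H ⟶ K) : H.carrier →L[ℂ] K.carrier := f

section Hilbert

variable {H H' K K' : Type*}
  [NormedAddCommGroup H] [InnerProductSpace ℂ H] [NormedAddCommGroup H'] [InnerProductSpace ℂ H']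
  [NormedAddCommGroup K] [InnerProductSpace ℂ K] [NormedAddCommGroup K'] [InnerProductSpace ℂ K']

/-- `[S]`: the closed linear span of a set of bounded operators. -/
def closedSpan (S : Set (H →L[ℂ] K)) : Submodule ℂ (H →L[ℂ] K) :=
  (Submodule.span ℂ S).topologicalClosure

/-- The normal functional `x ↦ ⟨η, x ξ⟩` on `B(H, K)`. -/
def vectorFunctional (η : K) (ξ : H) : StrongDual ℂ (H →L[ℂ] K) :=
  (innerSL ℂ η).comp (ContinuousLinearMap.apply ℂ K ξ)

variable (H K) in
/-- The predual `B(H, K)_*`: the norm closure of the span of the vector functionals. -/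
def normalFunctionals : Submodule ℂ (StrongDual ℂ (H →L[ℂ] K)) :=
  (Submodule.span ℂ {ω | ∃ (η : K) (ξ : H), ω = vectorFunctional η ξ}).topologicalClosure

variable (H K) in
/-- The Hilbert space tensor product. -/
abbrev HilbTensor : Type _ := UniformSpace.Completion (H ⊗[ℂ] K)

/-- The elementary tensor `ξ ⊗ η` in the Hilbert space tensor product. -/
def pureTensor (ξ : H) (η : K) : HilbTensor H K := ((ξ ⊗ₜ[ℂ] η : H ⊗[ℂ] K) : HilbTensor H K)

variable (H K) in
/-- `ξ ↦ (η ↦ ξ ⊗ η)`. -/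
def leftTensor : H →L[ℂ] K →L[ℂ] HilbTensor H K :=
  (ContinuousLinearMap.compL ℂ K (H ⊗[ℂ] K) (HilbTensor H K)
    (UniformSpace.Completion.toComplL (𝕜 := ℂ) (E := H ⊗[ℂ] K))).comp (TensorProduct.mkL ℂ H K)

theorem leftTensor_apply (ξ : H) (η : K) : leftTensor H K ξ η = pureTensor ξ η := rfl

theorem norm_pureTensor (ξ : H) (η : K) : ‖pureTensor ξ η‖ = ‖ξ‖ * ‖η‖ := by
  simp [pureTensor]

theorem norm_leftTensor_apply_le (ξ : H) : ‖leftTensor H K ξ‖ ≤ ‖ξ‖ :=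
  ContinuousLinearMap.opNorm_le_bound _ (norm_nonneg _) fun η => by
    rw [leftTensor_apply, norm_pureTensor]

/-- The operator `id_K ⊗ a` on `K ⊗ H`. -/
def idTensor (K : Type*) [NormedAddCommGroup K] [InnerProductSpace ℂ K]
    (a : H →L[ℂ] H') : HilbTensor K H →L[ℂ] HilbTensor K H' :=
  (a.lTensor K).completion

theorem idTensor_pureTensor (a : H →L[ℂ] H') (η : K) (ξ : H) :
    idTensor K a (pureTensor η ξ) = pureTensor η (a ξ) := by
  simp only [idTensor, pureTensor, ContinuousLinearMap.completion_apply_coe]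
  rw [ContinuousLinearMap.lTensor_tmul]

variable [CompleteSpace K']

/-- The operator `⟨η|_1 X |ξ⟩_1` from `K` to `K'`. -/
def innerLeg (X : HilbTensor H K →L[ℂ] HilbTensor H' K') (η : H') (ξ : H) : K →L[ℂ] K' :=
  (ContinuousLinearMap.adjoint (leftTensor H' K' η)).comp (X.comp (leftTensor H K ξ))

theorem innerLeg_add_right (X : HilbTensor H K →L[ℂ] HilbTensor H' K') (η : H') (ξ ξ' : H) :
    innerLeg X η (ξ + ξ') = innerLeg X η ξ + innerLeg X η ξ' := by
  simp only [innerLeg, map_add, ContinuousLinearMap.comp_add]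

theorem innerLeg_smul_right (X : HilbTensor H K →L[ℂ] HilbTensor H' K') (c : ℂ) (η : H')
    (ξ : H) : innerLeg X η (c • ξ) = c • innerLeg X η ξ := by
  simp only [innerLeg, map_smul, ContinuousLinearMap.comp_smul]

theorem innerLeg_add_left (X : HilbTensor H K →L[ℂ] HilbTensor H' K') (η η' : H') (ξ : H) :
    innerLeg X (η + η') ξ = innerLeg X η ξ + innerLeg X η' ξ := by
  simp only [innerLeg, map_add, ContinuousLinearMap.add_comp]

theorem innerLeg_smul_left (X : HilbTensor H K →L[ℂ] HilbTensor H' K') (c : ℂ) (η : H')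
    (ξ : H) : innerLeg X (c • η) ξ = (starRingEnd ℂ c) • innerLeg X η ξ := by
  simp only [innerLeg, map_smul, LinearIsometryEquiv.map_smulₛₗ, ContinuousLinearMap.smul_comp]

theorem norm_innerLeg_le (X : HilbTensor H K →L[ℂ] HilbTensor H' K') (η : H') (ξ : H) :
    ‖innerLeg X η ξ‖ ≤ ‖X‖ * ‖ξ‖ * ‖η‖ := by
  have h1 : ‖ContinuousLinearMap.adjoint (leftTensor H' K' η)‖ ≤ ‖η‖ := by
    rw [LinearIsometryEquiv.norm_map]; exact norm_leftTensor_apply_le η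
  have h2 : ‖X.comp (leftTensor H K ξ)‖ ≤ ‖X‖ * ‖ξ‖ :=
    (ContinuousLinearMap.opNorm_comp_le _ _).trans
      (mul_le_mul_of_nonneg_left (norm_leftTensor_apply_le ξ) (norm_nonneg _))
  calc ‖innerLeg X η ξ‖ ≤ ‖η‖ * (‖X‖ * ‖ξ‖) :=
        (ContinuousLinearMap.opNorm_comp_le _ _).trans
          (mul_le_mul h1 h2 (norm_nonneg _) (norm_nonneg _))
    _ = ‖X‖ * ‖ξ‖ * ‖η‖ := by ring

/-- The bounded form `(ξ, η) ↦ conj (ω (⟨η|_1 X |ξ⟩_1))`. -/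
def sliceForm (ω : StrongDual ℂ (K →L[ℂ] K')) (X : HilbTensor H K →L[ℂ] HilbTensor H' K') :
    H →L⋆[ℂ] H' →L[ℂ] ℂ :=
  LinearMap.mkContinuous₂
    (LinearMap.mk₂'ₛₗ (starRingEnd ℂ) (RingHom.id ℂ)
      (fun ξ η => (starRingEnd ℂ) (ω (innerLeg X η ξ)))
      (fun ξ ξ' η => by rw [innerLeg_add_right, map_add, map_add])
      (fun c ξ η => by rw [innerLeg_smul_right, map_smul, smul_eq_mul, map_mul, smul_eq_mul])
      (fun ξ η η' => by rw [innerLeg_add_left, map_add, map_add])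
      (fun c ξ η => by
        rw [innerLeg_smul_left, map_smul, smul_eq_mul, map_mul, Complex.conj_conj]; rfl))
    (‖ω‖ * ‖X‖)
    (fun ξ η => by
      simp only [LinearMap.mk₂'ₛₗ_apply, RCLike.norm_conj]
      refine (ω.le_opNorm _).trans ?_
      calc ‖ω‖ * ‖innerLeg X η ξ‖ ≤ ‖ω‖ * (‖X‖ * ‖ξ‖ * ‖η‖) :=
            mul_le_mul_of_nonneg_left (norm_innerLeg_le X η ξ) ω.opNorm_nonneg
        _ = ‖ω‖ * ‖X‖ * ‖ξ‖ * ‖η‖ := by ring)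

variable [CompleteSpace H']

/-- The slice `(id ⊗ ω)(X)`, the operator from `H` to `H'` which is characterised by
`⟨η, (id ⊗ ω)(X) ξ⟩ = ω (⟨η|_1 X |ξ⟩_1)`; see `inner_slice`. -/
def slice (ω : StrongDual ℂ (K →L[ℂ] K')) (X : HilbTensor H K →L[ℂ] HilbTensor H' K') :
    H →L[ℂ] H' :=
  ((InnerProductSpace.toDual ℂ H').symm.toContinuousLinearEquiv.toContinuousLinearMap).comp
    (sliceForm ω X)

theorem inner_slice (ω : StrongDual ℂ (K →L[ℂ] K'))
    (X : HilbTensor H K →L[ℂ] HilbTensor H' K') (η : H') (ξ : H) :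
    ⟪η, slice ω X ξ⟫_ℂ = ω (innerLeg X η ξ) := by
  rw [← inner_conj_symm]
  have : ⟪slice ω X ξ, η⟫_ℂ = sliceForm ω X ξ η :=
    InnerProductSpace.toDual_symm_apply
  rw [this, sliceForm, LinearMap.mkContinuous₂_apply, LinearMap.mk₂'ₛₗ_apply]
  exact Complex.conj_conj _

/-- The closed span of the slices `(id ⊗ ω)(X)`, where `ω` runs over `B(K, K')_*`. -/
def sliceSpace (X : HilbTensor H K →L[ℂ] HilbTensor H' K') : Submodule ℂ (H →L[ℂ] H') :=
  closedSpan {T | ∃ ω ∈ normalFunctionals K K', T = slice ω X}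

/-- `A` is a C*-subalgebra of `B(H)` that acts non-degenerately on `H`. -/
structure IsNondegenerateCStarSubalgebra [CompleteSpace H] (A : Submodule ℂ (H →L[ℂ] H)) : Prop where
  isClosed : IsClosed (A : Set (H →L[ℂ] H))
  mul_mem : ∀ a ∈ A, ∀ b ∈ A, a * b ∈ A
  star_mem : ∀ a ∈ A, star a ∈ A
  nondegenerate : (Submodule.span ℂ {x : H | ∃ a ∈ A, ∃ ξ : H, x = a ξ}).topologicalClosure = ⊤

/-- `m` lies in the multiplier algebra `M(A) ⊆ B(H)` of a non-degenerate C*-subalgebra `A`. -/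
def IsMultiplier (A : Submodule ℂ (H →L[ℂ] H)) (m : H →L[ℂ] H) : Prop :=
  ∀ a ∈ A, m * a ∈ A ∧ a * m ∈ A

end Hilbert

/-! ### Concrete monoidal W*-categories -/

/-- A normal strong monoidal functor from `C` to the category of Hilbert spaces with the Hilbert
space tensor product, with unitary structure maps. The coherence conditions are
stated on elementary tensors, which span dense subspaces. -/
structure FibreFunctor (C : Type u) [Category.{v} C] [CStarCategory C] [WStarCategory C]
    [MonoidalCategory C] where
  functor : C ⥤ HilbSp.{w}
  map_add : ∀ {X Y : C} (f g : X ⟶ Y),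
    HilbSp.toCLM (functor.map (f + g))
      = HilbSp.toCLM (functor.map f) + HilbSp.toCLM (functor.map g)
  map_smul : ∀ {X Y : C} (a : ℂ) (f : X ⟶ Y),
    HilbSp.toCLM (functor.map (a • f))
      = a • HilbSp.toCLM (functor.map f)
  map_dag : ∀ {X Y : C} (f : X ⟶ Y),
    HilbSp.toCLM (functor.map (dag f))
      = ContinuousLinearMap.adjoint (HilbSp.toCLM (functor.map f))
  normal : ∀ X Y : C,
    IsNormalMap (WStarCategory.predual X Y)
      (normalFunctionals (functor.obj X).carrier (functor.obj Y).carrier)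
      (fun f : X ⟶ Y => HilbSp.toCLM (functor.map f))
  /-- The unitary `For(X) ⊗ For(Y) → For(X ⊗ Y)`. -/
  tensorIso : ∀ X Y : C,
    HilbTensor (functor.obj X).carrier (functor.obj Y).carrier ≃ₗᵢ[ℂ] (functor.obj (X ⊗ Y)).carrier
  /-- The unitary `ℂ → For(𝟙)`. -/
  unitIso : ℂ ≃ₗᵢ[ℂ] (functor.obj (𝟙_ C)).carrier
  tensorIso_natural : ∀ {X X' Y Y' : C} (f : X ⟶ X') (g : Y ⟶ Y')
      (x : (functor.obj X).carrier) (y : (functor.obj Y).carrier),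
    HilbSp.toCLM (functor.map (f ⊗ₘ g))
        (tensorIso X Y (pureTensor x y))
      = tensorIso X' Y' (pureTensor
          (HilbSp.toCLM (functor.map f) x)
          (HilbSp.toCLM (functor.map g) y))
  associativity : ∀ (X Y Z : C) (x : (functor.obj X).carrier) (y : (functor.obj Y).carrier)
      (z : (functor.obj Z).carrier),
    HilbSp.toCLM (functor.map (α_ X Y Z).hom)
        (tensorIso (X ⊗ Y) Z (pureTensor (tensorIso X Y (pureTensor x y)) z))
      = tensorIso X (Y ⊗ Z) (pureTensor x (tensorIso Y Z (pureTensor y z)))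
  left_unitality : ∀ (X : C) (x : (functor.obj X).carrier),
    HilbSp.toCLM (functor.map (λ_ X).hom)
        (tensorIso (𝟙_ C) X (pureTensor (unitIso 1) x)) = x
  right_unitality : ∀ (X : C) (x : (functor.obj X).carrier),
    HilbSp.toCLM (functor.map (ρ_ X).hom)
        (tensorIso X (𝟙_ C) (pureTensor x (unitIso 1))) = x

section Concrete

variable {C : Type u} [Category.{v} C] [CStarCategory C] [WStarCategory C] [MonoidalCategory C]

/-- The Hilbert space underlying an object. -/
abbrev FibreFunctor.space (Φ : FibreFunctor.{u, v, w} C) (X : C) : Type w :=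
  (Φ.functor.obj X).carrier

/-- The bounded operator underlying a morphism. -/
def FibreFunctor.operator (Φ : FibreFunctor.{u, v, w} C) {X Y : C} (f : X ⟶ Y) :
    Φ.space X →L[ℂ] Φ.space Y :=
  HilbSp.toCLM (Φ.functor.map f)

/-- The bounded operator on Hilbert space tensor products underlying a morphism between tensor
products (the structure maps of the fibre functor are inserted). -/
def FibreFunctor.tensorOperator (Φ : FibreFunctor.{u, v, w} C) {X Y X' Y' : C}
    (f : X ⊗ Y ⟶ X' ⊗ Y') :
    HilbTensor (Φ.space X) (Φ.space Y) →L[ℂ] HilbTensor (Φ.space X') (Φ.space Y') :=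
  ((Φ.tensorIso X' Y').symm.toContinuousLinearEquiv.toContinuousLinearMap).comp
    ((Φ.operator f).comp (Φ.tensorIso X Y).toContinuousLinearEquiv.toContinuousLinearMap)

/-- `Â(X) = [(id ⊗ ω)(X) | ω ∈ B(K)_*]`. -/
def hatA (Φ : FibreFunctor.{u, v, w} C) {H K : C} (X : H ⊗ K ⟶ H ⊗ K) :
    Submodule ℂ (Φ.space H →L[ℂ] Φ.space H) :=
  sliceSpace (Φ.tensorOperator X)

/-- The inclusion `b ↦ id ⊠ b = id_{H₁} ⊗ b` into `B(H₁ ⊗ H₂)`. -/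
def inclRight (Φ : FibreFunctor.{u, v, w} C) (H₁ H₂ : C) (b : Φ.space H₂ →L[ℂ] Φ.space H₂) :
    HilbTensor (Φ.space H₁) (Φ.space H₂) →L[ℂ] HilbTensor (Φ.space H₁) (Φ.space H₂) :=
  idTensor (Φ.space H₁) b

variable [BraidedCategory C]

/-- The braiding `c` is unitary, and `[(id ⊗ ω)(c_{H,K}) | ω ∈ B(K, H)_*]` is the space of compact
operators from `H` to `K`, for all objects `H`, `K`. -/
def IsRegularBraiding (Φ : FibreFunctor.{u, v, w} C) : Prop :=
  ∀ H K : C, IsUnitaryHom (β_ H K).hom ∧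
    (sliceSpace (Φ.tensorOperator (β_ H K).hom) : Set (Φ.space H →L[ℂ] Φ.space K))
      = {T : Φ.space H →L[ℂ] Φ.space K | IsCompactOperator T}

/-- `F` is a unitary solution of the braided pentagon equation
`F₂₃ F₁₂ = F₁₂ c₁₂⁻¹ F₂₃ c₁₂ F₂₃`, here as an equation in `End((L ⊗ L) ⊗ L)`. -/
def IsMultiplicativeUnitary {L : C} (F : L ⊗ L ⟶ L ⊗ L) : Prop :=
  IsUnitaryHom F ∧
    (let F₁₂ : (L ⊗ L) ⊗ L ⟶ (L ⊗ L) ⊗ L := F ▷ L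
     let F₂₃ : (L ⊗ L) ⊗ L ⟶ (L ⊗ L) ⊗ L := (α_ L L L).hom ≫ L ◁ F ≫ (α_ L L L).inv
     F₁₂ ≫ F₂₃ = F₂₃ ≫ (β_ L L).hom ▷ L ≫ F₂₃ ≫ (β_ L L).inv ▷ L ≫ F₁₂)

/-- `C(F) = [(id ⊗ ω)(c⁻¹ F) | ω ∈ B(L)_*]` is the space of compact operators. -/
def IsRegularUnitary (Φ : FibreFunctor.{u, v, w} C) {L : C} (F : L ⊗ L ⟶ L ⊗ L) : Prop :=
  (sliceSpace (Φ.tensorOperator (F ≫ (β_ L L).inv)) : Set (Φ.space L →L[ℂ] Φ.space L))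
    = {T : Φ.space L →L[ℂ] Φ.space L | IsCompactOperator T}

/-- `F̂ = c⁻¹ F* c`. -/
def dualUnitary {L : C} (F : L ⊗ L ⟶ L ⊗ L) : L ⊗ L ⟶ L ⊗ L :=
  (β_ L L).hom ≫ dag F ≫ (β_ L L).inv

/-- The inclusion `a ↦ a ⊠ id = c_{H₂,H₁} (id_{H₂} ⊗ a) c_{H₂,H₁}⁻¹` into `B(H₁ ⊗ H₂)`. -/
def inclLeft (Φ : FibreFunctor.{u, v, w} C) (H₁ H₂ : C) (a : Φ.space H₁ →L[ℂ] Φ.space H₁) :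
    HilbTensor (Φ.space H₁) (Φ.space H₂) →L[ℂ] HilbTensor (Φ.space H₁) (Φ.space H₂) :=
  (Φ.tensorOperator (β_ H₂ H₁).hom).comp
    ((idTensor (Φ.space H₂) a).comp (Φ.tensorOperator (β_ H₂ H₁).inv))

/-- The braided tensor product `A₁ ⊠ A₂ = [(A₁ ⊠ id)(id ⊠ A₂)]`. -/
def braidedTensor (Φ : FibreFunctor.{u, v, w} C) {H₁ H₂ : C}
    (A₁ : Submodule ℂ (Φ.space H₁ →L[ℂ] Φ.space H₁))
    (A₂ : Submodule ℂ (Φ.space H₂ →L[ℂ] Φ.space H₂)) :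
    Submodule ℂ (HilbTensor (Φ.space H₁) (Φ.space H₂) →L[ℂ]
      HilbTensor (Φ.space H₁) (Φ.space H₂)) :=
  closedSpan {T | ∃ a ∈ A₁, ∃ b ∈ A₂, T = inclLeft Φ H₁ H₂ a * inclRight Φ H₁ H₂ b}

end Concrete

end

/-!
The braiding `c = c_{L,L}` and `F` are treated through the two unitaries `c` and `g = c⁻¹F` on
`H ⊗ H`, where `H` is the Hilbert space of `L`. On the legs 12 and 23 of a threefold tensor product,
the Yang--Baxter equation, the naturality of the braiding with respect to `F` and the braided
pentagon equation become the relations `IsBraidedPair`, of which the last one is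
`g₂₃ g₁₂ g₂₃ = g₁₂ c₂₃⁻¹ g₁₂`. They are invariant under `(c, g) ↦ (c⁻¹, g⁻¹)`, and this exchanges
`Â(F)`, the slices of `cg`, with `Â(F̂)`, the slices of `c⁻¹g⁻¹`.

Regularity enters through one device, `closedMul_sandwich_sandwich`. A product of two slices
`⟨η|W₁|ξ⟩⟨η'|W₂|ξ'⟩` contains the operator `|ξ⟩⟨η'|` of rank one. If the slices of a unitary `Y` on
`H ⊗ H` span the compact operators, this operator may be exchanged for slices of `Y`, so that the
closed product of two spaces of slices is the space of slices, in one leg more, of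
`W₁ Y W₂`. This applies to `c`, `g` and their inverses. Moreover, slices in the last two legs do not
change if a unitary on these legs is multiplied from the left or from the right. So identities
between closed products of spaces of slices follow from identities in a group, up to such factors.

With `Y = g`, the pentagon equation gives `Â(F) Â(F)* = Â(F)*`, whence `Â(F)` is selfadjoint and
an algebra. The spaces `Â(F) ⊠ id` and `id ⊠ Â(F̂)` are the slices in the third leg of the operators
`leftUnit` and `rightUnit`. With `Y = c` and `Y = c⁻¹`, the products of these two spaces in both
orders agree (`closedMul_comm`), so `Â(F) ⊠ Â(F̂)` is a C*-algebra. With `Y = g` and `Y = g⁻¹`,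
the factor `F` is absorbed (`lastSlices_left_mul`, `lastSlices_right_mul`):
`[(Â(F) ⊠ id) F (id ⊠ Â(F̂))]` and `[(id ⊠ Â(F̂)) (Â(F) ⊠ id) F]` are both equal to
`Â(F) ⊠ Â(F̂)`. The second identity and its adjoint say that `F` is a multiplier.
-/

noncomputable section

open CStarCategory

/-! ### Operators on Hilbert space tensor products -/

section TensorProducts

variable {V V' V'' H H' H'' K Z : Type*}
  [NormedAddCommGroup V] [InnerProductSpace ℂ V]
  [NormedAddCommGroup V'] [InnerProductSpace ℂ V']
  [NormedAddCommGroup V''] [InnerProductSpace ℂ V'']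
  [NormedAddCommGroup H] [InnerProductSpace ℂ H]
  [NormedAddCommGroup H'] [InnerProductSpace ℂ H']
  [NormedAddCommGroup H''] [InnerProductSpace ℂ H'']
  [NormedAddCommGroup K] [InnerProductSpace ℂ K]
  [NormedAddCommGroup Z] [InnerProductSpace ℂ Z]

theorem HilbTensor.ext_clm {f g : HilbTensor V H →L[ℂ] Z}
    (h : ∀ v x, f (pureTensor v x) = g (pureTensor v x)) : f = g := by
  ext t
  induction t using UniformSpace.Completion.induction_on with
  | hp => exact isClosed_eq f.continuous g.continuous
  | ih t =>
    induction t with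
    | zero => rw [UniformSpace.Completion.coe_zero, map_zero, map_zero]
    | tmul v x => exact h v x
    | add s t hs ht => rw [UniformSpace.Completion.coe_add, map_add, map_add, hs, ht]

theorem inner_pureTensor (v v' : V) (x x' : H) :
    ⟪pureTensor v x, pureTensor v' x'⟫_ℂ = ⟪v, v'⟫_ℂ * ⟪x, x'⟫_ℂ := by
  simp [pureTensor]

theorem HilbTensor.ext_inner {s t : HilbTensor V H}
    (h : ∀ v x, ⟪pureTensor v x, s⟫_ℂ = ⟪pureTensor v x, t⟫_ℂ) : s = t := by
  have : innerSL ℂ s = innerSL ℂ t := HilbTensor.ext_clm fun v x => by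
    rw [innerSL_apply_apply, innerSL_apply_apply, ← inner_conj_symm, h, inner_conj_symm]
  refine ext_inner_right ℂ fun r => ?_
  simpa using congrArg (fun f => f r) this

variable (V) in
/-- The operator `v ↦ v ⊗ x`. -/
def rightTensor (x : H) : V →L[ℂ] HilbTensor V H := (leftTensor V H).flip x

@[simp]
theorem rightTensor_apply (x : H) (v : V) : rightTensor V x v = pureTensor v x := rfl

variable (V H) in
/-- `x ↦ (v ↦ v ⊗ x)` as a bounded linear map. -/
def rightTensorL : H →L[ℂ] V →L[ℂ] HilbTensor V H := (leftTensor V H).flip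

theorem rightTensorL_apply (x : H) : rightTensorL V H x = rightTensor V x := rfl

theorem adjoint_rightTensor_pureTensor [CompleteSpace V] (x : H) (v : V) (y : H) :
    ContinuousLinearMap.adjoint (rightTensor V x) (pureTensor v y) = ⟪x, y⟫_ℂ • v := by
  refine ext_inner_left ℂ fun w => ?_
  rw [ContinuousLinearMap.adjoint_inner_right, rightTensor_apply, inner_pureTensor,
    inner_smul_right, mul_comm]

variable (H) in
/-- The operator `a ⊗ id_H`. -/
def tensorId (a : V →L[ℂ] V') : HilbTensor V H →L[ℂ] HilbTensor V' H :=
  (a.rTensor H).completion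

@[simp]
theorem tensorId_pureTensor (a : V →L[ℂ] V') (v : V) (x : H) :
    tensorId H a (pureTensor v x) = pureTensor (a v) x := by
  simp only [tensorId, pureTensor, ContinuousLinearMap.completion_apply_coe]
  rw [ContinuousLinearMap.rTensor_tmul]

attribute [simp] idTensor_pureTensor

theorem tensorId_comp (a : V' →L[ℂ] V'') (b : V →L[ℂ] V') :
    tensorId H (a.comp b) = (tensorId H a).comp (tensorId H b) :=
  HilbTensor.ext_clm fun v x => by simp

theorem tensorId_id : tensorId H (ContinuousLinearMap.id ℂ V) = ContinuousLinearMap.id ℂ _ :=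
  HilbTensor.ext_clm fun v x => by simp

theorem idTensor_comp (a : H' →L[ℂ] H'') (b : H →L[ℂ] H') :
    idTensor V (a.comp b) = (idTensor V a).comp (idTensor V b) :=
  HilbTensor.ext_clm fun v x => by simp

theorem idTensor_id : idTensor V (ContinuousLinearMap.id ℂ H) = ContinuousLinearMap.id ℂ _ :=
  HilbTensor.ext_clm fun v x => by simp

theorem pureTensor_add_right (v : V) (x y : H) :
    pureTensor v (x + y) = pureTensor v x + pureTensor v y := map_add (leftTensor V H v) x y

theorem pureTensor_smul_right (v : V) (a : ℂ) (x : H) :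
    pureTensor v (a • x) = a • pureTensor v x := map_smul (leftTensor V H v) a x

theorem norm_idTensor_le (a : H →L[ℂ] H') : ‖idTensor V a‖ ≤ ‖a‖ := by
  refine ContinuousLinearMap.opNorm_le_bound _ (norm_nonneg _) fun t => ?_
  induction t using UniformSpace.Completion.induction_on with
  | hp =>
    exact isClosed_le (idTensor V a).continuous.norm (continuous_const.mul continuous_norm)
  | ih t =>
    rw [idTensor, ContinuousLinearMap.completion_apply_coe, UniformSpace.Completion.norm_coe,
      UniformSpace.Completion.norm_coe]
    exact ((a.lTensor V).le_opNorm t).trans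
      (mul_le_mul_of_nonneg_right (ContinuousLinearMap.norm_lTensor_le (G := V) a) (norm_nonneg _))

variable (V H H') in
/-- `a ↦ id_V ⊗ a` as a bounded linear map. -/
def idTensorL : (H →L[ℂ] H') →L[ℂ] HilbTensor V H →L[ℂ] HilbTensor V H' :=
  LinearMap.mkContinuous
    { toFun := idTensor V
      map_add' := fun a b => HilbTensor.ext_clm fun v x => by simp [pureTensor_add_right]
      map_smul' := fun c a => HilbTensor.ext_clm fun v x => by simp [pureTensor_smul_right] }
    1 fun a => by simpa using norm_idTensor_le a

@[simp]
theorem idTensorL_apply (a : H →L[ℂ] H') : idTensorL V H H' a = idTensor V a := rfl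

theorem adjoint_idTensor [CompleteSpace H] [CompleteSpace H'] (a : H →L[ℂ] H') :
    ContinuousLinearMap.adjoint (idTensor V a) = idTensor V (ContinuousLinearMap.adjoint a) := by
  refine HilbTensor.ext_clm fun v x => HilbTensor.ext_inner fun w y => ?_
  rw [ContinuousLinearMap.adjoint_inner_right, idTensor_pureTensor, idTensor_pureTensor,
    inner_pureTensor, inner_pureTensor, ContinuousLinearMap.adjoint_inner_right]

/-- A bilinear map which multiplies inner products extends to an isometry on the Hilbert space
tensor product. -/
def HilbTensor.liftIsometry [CompleteSpace Z] (b : V →ₗ[ℂ] H →ₗ[ℂ] Z)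
    (hb : ∀ v x v' x', ⟪b v x, b v' x'⟫_ℂ = ⟪v, v'⟫_ℂ * ⟪x, x'⟫_ℂ) : HilbTensor V H →ₗᵢ[ℂ] Z :=
  have h : ∀ s t, ⟪TensorProduct.lift b s, TensorProduct.lift b t⟫_ℂ = ⟪s, t⟫_ℂ := fun s t => by
    induction s with
    | zero => simp
    | add s s' hs hs' => rw [map_add, inner_add_left, inner_add_left, hs, hs']
    | tmul v x =>
      induction t with
      | zero => simp
      | add t t' ht ht' => rw [map_add, inner_add_right, inner_add_right, ht, ht']
      | tmul v' x' => simpa using hb v x v' x'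
  let f := ((TensorProduct.lift b).isometryOfInner h)
  { toLinearMap := f.toContinuousLinearMap.fromCompletion.toLinearMap
    norm_map' := fun t => by
      induction t using UniformSpace.Completion.induction_on with
      | hp =>
        exact isClosed_eq (f.toContinuousLinearMap.fromCompletion.continuous.norm) continuous_norm
      | ih t =>
        simp }

@[simp]
theorem HilbTensor.liftIsometry_pureTensor [CompleteSpace Z] (b : V →ₗ[ℂ] H →ₗ[ℂ] Z)
    (hb : ∀ v x v' x', ⟪b v x, b v' x'⟫_ℂ = ⟪v, v'⟫_ℂ * ⟪x, x'⟫_ℂ) (v : V) (x : H) :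
    HilbTensor.liftIsometry b hb (pureTensor v x) = b v x := by
  simp [HilbTensor.liftIsometry, pureTensor]

theorem HilbTensor.mem_of_isClosed {S : Submodule ℂ (HilbTensor V H)}
    (hS : IsClosed (S : Set (HilbTensor V H))) (h : ∀ v x, pureTensor v x ∈ S)
    (t : HilbTensor V H) : t ∈ S := by
  induction t using UniformSpace.Completion.induction_on with
  | hp => exact hS
  | ih t =>
    induction t with
    | zero => rw [UniformSpace.Completion.coe_zero]; exact S.zero_mem
    | tmul v x => exact h v x
    | add s t hs ht => rw [UniformSpace.Completion.coe_add]; exact S.add_mem hs ht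

theorem HilbTensor.ext_clm₃ {f g : HilbTensor (HilbTensor V H) K →L[ℂ] Z}
    (h : ∀ v x k, f (pureTensor (pureTensor v x) k) = g (pureTensor (pureTensor v x) k)) :
    f = g := by
  refine HilbTensor.ext_clm fun t k => ?_
  have : f.comp (rightTensor _ k) = g.comp (rightTensor _ k) :=
    HilbTensor.ext_clm fun v x => by simpa using h v x k
  simpa using congrArg (fun f => f t) this

theorem adjoint_rightTensor_comp_rightTensor [CompleteSpace V] (x y : H) :
    (ContinuousLinearMap.adjoint (rightTensor V x)).comp (rightTensor V y)
      = ⟪x, y⟫_ℂ • ContinuousLinearMap.id ℂ V := by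
  ext v
  simp [adjoint_rightTensor_pureTensor]

variable (V H) in
/-- `a ↦ a ⊗ id_H` as a monoid homomorphism. -/
def tensorIdHom : (V →L[ℂ] V) →* (HilbTensor V H →L[ℂ] HilbTensor V H) where
  toFun := tensorId H
  map_one' := tensorId_id
  map_mul' := tensorId_comp

/-- `Z ↦ B Z A` for mutually inverse operators `A` and `B`, as a monoid homomorphism. -/
def conjHom (A : V →L[ℂ] H) (B : H →L[ℂ] V) (hAB : A.comp B = ContinuousLinearMap.id ℂ H)
    (hBA : B.comp A = ContinuousLinearMap.id ℂ V) : (H →L[ℂ] H) →* (V →L[ℂ] V) where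
  toFun Z := B.comp (Z.comp A)
  map_one' := hBA
  map_mul' Y Z := by
    ext v
    exact congrArg (fun s => B (Y s)) (congrArg (fun f => f (Z (A v))) hAB).symm

/-! ### Associativity of the Hilbert space tensor product -/

variable [CompleteSpace V] [CompleteSpace H]

variable (V H K) in
/-- The isometry `(V ⊗ H) ⊗ K → V ⊗ (H ⊗ K)`, which sends `t ⊗ k` to `(id_V ⊗ |k⟩) t`. -/
def HilbTensor.assocIsometry :
    HilbTensor (HilbTensor V H) K →ₗᵢ[ℂ] HilbTensor V (HilbTensor H K) :=
  HilbTensor.liftIsometry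
    (LinearMap.mk₂ ℂ (fun t k => idTensorL V H _ (rightTensorL H K k) t)
      (fun _ _ _ => map_add _ _ _) (fun _ _ _ => map_smul _ _ _)
      (fun _ _ _ => by simp only [map_add, add_apply])
      (fun _ _ _ => by simp only [map_smul, smul_apply]))
    (fun s x t y => by
      simp only [LinearMap.mk₂_apply, rightTensorL_apply, idTensorL_apply]
      rw [← ContinuousLinearMap.adjoint_inner_right, adjoint_idTensor,
        ← ContinuousLinearMap.comp_apply, ← idTensor_comp, adjoint_rightTensor_comp_rightTensor,
        ← idTensorL_apply, map_smul, idTensorL_apply, idTensor_id,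
        smul_apply, inner_smul_right, mul_comm]
      rfl)

omit [CompleteSpace V] in
theorem HilbTensor.assocIsometry_pureTensor (v : V) (x : H) (k : K) :
    HilbTensor.assocIsometry V H K (pureTensor (pureTensor v x) k)
      = pureTensor v (pureTensor x k) := by
  simp [HilbTensor.assocIsometry, rightTensorL_apply]

variable (V H K) in
theorem HilbTensor.assocIsometry_surjective :
    Function.Surjective (HilbTensor.assocIsometry V H K) := by
  have hc : IsClosed
      ((LinearMap.range (HilbTensor.assocIsometry V H K).toLinearMap : Submodule ℂ _) :
        Set (HilbTensor V (HilbTensor H K))) := by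
    rw [LinearMap.coe_range]
    exact (HilbTensor.assocIsometry V H K).isometry.isClosedEmbedding.isClosed_range
  intro t
  refine HilbTensor.mem_of_isClosed hc (fun v s => ?_) t
  exact HilbTensor.mem_of_isClosed
    (S := Submodule.comap (leftTensor V (HilbTensor H K) v).toLinearMap
      (LinearMap.range (HilbTensor.assocIsometry V H K).toLinearMap))
    (hc.preimage (leftTensor V (HilbTensor H K) v).continuous)
    (fun x k => ⟨_, HilbTensor.assocIsometry_pureTensor v x k⟩) s

variable (V H K) in
/-- The associator `(V ⊗ H) ⊗ K ≃ V ⊗ (H ⊗ K)`. -/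
def HilbTensor.assoc :
    HilbTensor (HilbTensor V H) K ≃ₗᵢ[ℂ] HilbTensor V (HilbTensor H K) :=
  LinearIsometryEquiv.ofSurjective _ (HilbTensor.assocIsometry_surjective V H K)

@[simp]
theorem HilbTensor.assoc_pureTensor (v : V) (x : H) (k : K) :
    HilbTensor.assoc V H K (pureTensor (pureTensor v x) k) = pureTensor v (pureTensor x k) :=
  HilbTensor.assocIsometry_pureTensor v x k

@[simp]
theorem HilbTensor.assoc_symm_pureTensor (v : V) (x : H) (k : K) :
    (HilbTensor.assoc V H K).symm (pureTensor v (pureTensor x k))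
      = pureTensor (pureTensor v x) k := by
  rw [LinearIsometryEquiv.symm_apply_eq, HilbTensor.assoc_pureTensor]

/-! ### Leg numbering -/

variable (V H K) in
/-- `X ↦ id_V ⊗ X`, for operators `X` on `H ⊗ K`, as operators on `(V ⊗ H) ⊗ K`. -/
def lastTwo : (HilbTensor H K →L[ℂ] HilbTensor H K) →*
    (HilbTensor (HilbTensor V H) K →L[ℂ] HilbTensor (HilbTensor V H) K) where
  toFun X := ((HilbTensor.assoc V H K).symm.toContinuousLinearEquiv.toContinuousLinearMap).comp
    ((idTensor V X).comp (HilbTensor.assoc V H K).toContinuousLinearEquiv.toContinuousLinearMap)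
  map_one' := by
    ext t
    simp [ContinuousLinearMap.one_def, idTensor_id]
  map_mul' X Y := by
    ext t
    simp [ContinuousLinearMap.mul_def, idTensor_comp]

theorem lastTwo_apply (X : HilbTensor H K →L[ℂ] HilbTensor H K)
    (t : HilbTensor (HilbTensor V H) K) :
    lastTwo V H K X t
      = (HilbTensor.assoc V H K).symm (idTensor V X (HilbTensor.assoc V H K t)) := rfl

theorem lastTwo_pureTensor (X : HilbTensor H K →L[ℂ] HilbTensor H K) (v : V) (x : H) (k : K) :
    lastTwo V H K X (pureTensor (pureTensor v x) k)
      = (HilbTensor.assoc V H K).symm (pureTensor v (X (pureTensor x k))) := by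
  simp [lastTwo_apply]

variable (V H K) in
theorem star_lastTwo [CompleteSpace K] (X : HilbTensor H K →L[ℂ] HilbTensor H K) :
    star (lastTwo V H K X) = lastTwo V H K (star X) := by
  rw [ContinuousLinearMap.star_eq_adjoint, eq_comm, ContinuousLinearMap.eq_adjoint_iff]
  intro s t
  rw [lastTwo_apply, lastTwo_apply, ContinuousLinearMap.star_eq_adjoint, ← adjoint_idTensor,
    LinearIsometryEquiv.inner_map_eq_flip, LinearIsometryEquiv.symm_symm,
    ContinuousLinearMap.adjoint_inner_left, ← LinearIsometryEquiv.inner_map_eq_flip]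

/-- Operators on disjoint legs commute. -/
theorem commute_tensorId_lastTwo (Y : V →L[ℂ] V) (X : HilbTensor H K →L[ℂ] HilbTensor H K) :
    Commute (tensorId K (tensorId H Y)) (lastTwo V H K X) := by
  refine HilbTensor.ext_clm₃ fun v x k => ?_
  rw [mul_apply_eq_comp, mul_apply_eq_comp, tensorId_pureTensor,
    tensorId_pureTensor, lastTwo_pureTensor, lastTwo_pureTensor]
  have : ((tensorId K (tensorId H Y)).comp
        (HilbTensor.assoc V H K).symm.toContinuousLinearEquiv.toContinuousLinearMap).comp
        (leftTensor V _ v)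
      = ((HilbTensor.assoc V H K).symm.toContinuousLinearEquiv.toContinuousLinearMap).comp
        (leftTensor V _ (Y v)) :=
    HilbTensor.ext_clm fun x k => by simp [leftTensor_apply]
  simpa [leftTensor_apply] using congrArg (fun f => f (X (pureTensor x k))) this

variable (V H K) in
/-- `Z ↦ id_V ⊗ Z`, for operators `Z` on `(H ⊗ H) ⊗ K`, as operators on `((V ⊗ H) ⊗ H) ⊗ K`. -/
def lastThree : (HilbTensor (HilbTensor H H) K →L[ℂ] HilbTensor (HilbTensor H H) K) →*
    (HilbTensor (HilbTensor (HilbTensor V H) H) K →L[ℂ]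
      HilbTensor (HilbTensor (HilbTensor V H) H) K) :=
  (conjHom (tensorId K (HilbTensor.assoc V H H).toContinuousLinearEquiv.toContinuousLinearMap)
    (tensorId K (HilbTensor.assoc V H H).symm.toContinuousLinearEquiv.toContinuousLinearMap)
    (HilbTensor.ext_clm fun t k => by simp) (HilbTensor.ext_clm fun t k => by simp)).comp
  (lastTwo V (HilbTensor H H) K)

theorem lastThree_apply (Z : HilbTensor (HilbTensor H H) K →L[ℂ] HilbTensor (HilbTensor H H) K)
    (t : HilbTensor (HilbTensor (HilbTensor V H) H) K) :
    lastThree V H K Z t = tensorId K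
      (HilbTensor.assoc V H H).symm.toContinuousLinearEquiv.toContinuousLinearMap
      (lastTwo V (HilbTensor H H) K Z (tensorId K
        (HilbTensor.assoc V H H).toContinuousLinearEquiv.toContinuousLinearMap t)) := rfl

variable (V) in
theorem lastThree_tensorId (X : HilbTensor H H →L[ℂ] HilbTensor H H) :
    lastThree V H K (tensorId K X) = tensorId K (lastTwo V H H X) := by
  refine HilbTensor.ext_clm₃ fun t x k => ?_
  rw [lastThree_apply]
  have h : lastTwo V (HilbTensor H H) K (tensorId K X) = tensorId K (idTensor V X) :=
    HilbTensor.ext_clm₃ fun v s k => by simp [lastTwo_pureTensor]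
  rw [h]
  simp [lastTwo_apply]

variable (V) in
theorem lastThree_lastTwo (X : HilbTensor H K →L[ℂ] HilbTensor H K) :
    lastThree V H K (lastTwo H H K X) = lastTwo (HilbTensor V H) H K X := by
  refine HilbTensor.ext_clm₃ fun t x k => ?_
  have h1 : ((lastThree V H K (lastTwo H H K X)).comp (rightTensor _ k)).comp (rightTensor _ x)
      = ((lastTwo (HilbTensor V H) H K X).comp (rightTensor _ k)).comp (rightTensor _ x) := by
    refine HilbTensor.ext_clm fun v y => ?_
    have : ((tensorId K
          (HilbTensor.assoc V H H).symm.toContinuousLinearEquiv.toContinuousLinearMap).comp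
          ((HilbTensor.assoc V (HilbTensor H H) K).symm.toContinuousLinearEquiv.toContinuousLinearMap.comp
          (leftTensor V _ v))).comp
          ((HilbTensor.assoc H H K).symm.toContinuousLinearEquiv.toContinuousLinearMap.comp
          (leftTensor H _ y))
        = (HilbTensor.assoc (HilbTensor V H) H K).symm.toContinuousLinearEquiv.toContinuousLinearMap.comp
          (leftTensor _ _ (pureTensor v y)) :=
      HilbTensor.ext_clm fun x k => by simp [leftTensor_apply]
    simpa [lastThree_apply, lastTwo_pureTensor, leftTensor_apply] using
      congrArg (fun f => f (X (pureTensor x k))) this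
  simpa using congrArg (fun f => f t) h1

end TensorProducts

/-! ### Closed spans and closed products of operator spaces -/

section ClosedSpans

variable {V H K X : Type*}
  [NormedAddCommGroup V] [InnerProductSpace ℂ V]
  [NormedAddCommGroup H] [InnerProductSpace ℂ H]
  [NormedAddCommGroup K] [InnerProductSpace ℂ K]
  [NormedAddCommGroup X] [NormedSpace ℂ X]

theorem subset_closedSpan (S : Set (H →L[ℂ] K)) : S ⊆ closedSpan S :=
  Submodule.subset_span.trans (Submodule.le_topologicalClosure _)

theorem isClosed_closedSpan (S : Set (H →L[ℂ] K)) :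
    IsClosed (closedSpan S : Set (H →L[ℂ] K)) := Submodule.isClosed_topologicalClosure _

/-- A continuous semilinear map which sends a set into a closed subspace sends its closed span
into this subspace. -/
theorem map_mem_of_mem_closedSpan {σ : ℂ →+* ℂ} {S : Set (H →L[ℂ] K)} {M : Submodule ℂ X}
    (hM : IsClosed (M : Set X)) (Φ : (H →L[ℂ] K) →SL[σ] X) (h : ∀ T ∈ S, Φ T ∈ M)
    {T : H →L[ℂ] K} (hT : T ∈ closedSpan S) : Φ T ∈ M :=
  Submodule.topologicalClosure_minimal (t := M.comap Φ.toLinearMap) _ (Submodule.span_le.2 h)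
    (hM.preimage Φ.continuous) hT

theorem closedSpan_le {S : Set (H →L[ℂ] K)} {M : Submodule ℂ (H →L[ℂ] K)}
    (hM : IsClosed (M : Set (H →L[ℂ] K))) (h : S ⊆ M) : closedSpan S ≤ M :=
  Submodule.topologicalClosure_minimal _ (Submodule.span_le.2 h) hM

/-- Composition with fixed operators on both sides, as a bounded linear map. -/
def compBoth (a : K →L[ℂ] X) (b : V →L[ℂ] H) : (H →L[ℂ] K) →L[ℂ] (V →L[ℂ] X) :=
  (ContinuousLinearMap.compL ℂ V K X a).comp ((ContinuousLinearMap.compL ℂ V H K).flip b)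

theorem compBoth_one_left (b T : V →L[ℂ] V) : compBoth 1 b T = T * b := by
  ext x
  rfl

theorem compBoth_one_right (a T : V →L[ℂ] V) : compBoth a 1 T = a * T := by
  ext x
  rfl

/-- The closed linear span of the products of the elements of two spaces of operators. -/
def closedMul (P Q : Submodule ℂ (V →L[ℂ] V)) : Submodule ℂ (V →L[ℂ] V) :=
  (P * Q).topologicalClosure

theorem isClosed_closedMul (P Q : Submodule ℂ (V →L[ℂ] V)) :
    IsClosed (closedMul P Q : Set (V →L[ℂ] V)) := Submodule.isClosed_topologicalClosure _

theorem mul_mem_closedMul {P Q : Submodule ℂ (V →L[ℂ] V)} {a b : V →L[ℂ] V} (ha : a ∈ P)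
    (hb : b ∈ Q) : a * b ∈ closedMul P Q :=
  Submodule.le_topologicalClosure _ (Submodule.mul_mem_mul ha hb)

theorem closedMul_le {P Q M : Submodule ℂ (V →L[ℂ] V)} (hM : IsClosed (M : Set (V →L[ℂ] V)))
    (h : ∀ a ∈ P, ∀ b ∈ Q, a * b ∈ M) : closedMul P Q ≤ M :=
  Submodule.topologicalClosure_minimal _ (Submodule.mul_le.2 h) hM

theorem map_mem_of_mem_closedMul {σ : ℂ →+* ℂ} {P Q : Submodule ℂ (V →L[ℂ] V)}
    {M : Submodule ℂ X} (hM : IsClosed (M : Set X)) (Φ : (V →L[ℂ] V) →SL[σ] X)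
    (h : ∀ a ∈ P, ∀ b ∈ Q, Φ (a * b) ∈ M) {T : V →L[ℂ] V} (hT : T ∈ closedMul P Q) :
    Φ T ∈ M :=
  Submodule.topologicalClosure_minimal (t := M.comap Φ.toLinearMap) _ (Submodule.mul_le.2 h)
    (hM.preimage Φ.continuous) hT

theorem closedMul_assoc (P Q R : Submodule ℂ (V →L[ℂ] V)) :
    closedMul (closedMul P Q) R = closedMul P (closedMul Q R) := by
  refine le_antisymm (closedMul_le (isClosed_closedMul _ _) fun x hx c hc => ?_)
    (closedMul_le (isClosed_closedMul _ _) fun a ha x hx => ?_)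
  · rw [← compBoth_one_left]
    refine map_mem_of_mem_closedMul (isClosed_closedMul P (closedMul Q R))
      (compBoth 1 c) (fun a ha b hb => ?_) hx
    rw [compBoth_one_left, mul_assoc]
    exact mul_mem_closedMul ha (mul_mem_closedMul hb hc)
  · rw [← compBoth_one_right]
    refine map_mem_of_mem_closedMul (isClosed_closedMul (closedMul P Q) R)
      (compBoth a 1) (fun b hb c hc => ?_) hx
    rw [compBoth_one_right, ← mul_assoc]
    exact mul_mem_closedMul (mul_mem_closedMul ha hb) hc

theorem star_mem_closedMul [CompleteSpace V] {P Q P' Q' : Submodule ℂ (V →L[ℂ] V)}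
    (hP : ∀ a ∈ P, star a ∈ P') (hQ : ∀ b ∈ Q, star b ∈ Q') {T : V →L[ℂ] V}
    (hT : T ∈ closedMul P Q) : star T ∈ closedMul Q' P' :=
  map_mem_of_mem_closedMul (isClosed_closedMul _ _)
    (starL ℂ : (V →L[ℂ] V) ≃L⋆[ℂ] (V →L[ℂ] V)).toContinuousLinearMap
    (fun a ha b hb => by
      simpa using mul_mem_closedMul (hQ b hb) (hP a ha)) hT

/-- Closed spans of products may be computed on generators. -/
theorem closedSpan_map_mul_map (Φ : (H →L[ℂ] H) →L[ℂ] (V →L[ℂ] V))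
    (Ψ : (K →L[ℂ] K) →L[ℂ] (V →L[ℂ] V)) (S : Set (H →L[ℂ] H)) (S' : Set (K →L[ℂ] K)) :
    closedSpan {T | ∃ a ∈ closedSpan S, ∃ b ∈ closedSpan S', T = Φ a * Ψ b}
      = closedMul (closedSpan (Φ '' S)) (closedSpan (Ψ '' S')) := by
  have hM := isClosed_closedSpan
    {T | ∃ a ∈ closedSpan S, ∃ b ∈ closedSpan S', T = Φ a * Ψ b}
  refine le_antisymm (closedSpan_le (isClosed_closedMul _ _) ?_)
    (closedMul_le (isClosed_closedSpan _) fun a ha b hb => ?_)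
  · rintro _ ⟨a, ha, b, hb, rfl⟩
    exact mul_mem_closedMul
      (map_mem_of_mem_closedSpan (isClosed_closedSpan (Φ '' S)) Φ
        (fun T hT => subset_closedSpan _ ⟨T, hT, rfl⟩) ha)
      (map_mem_of_mem_closedSpan (isClosed_closedSpan (Ψ '' S')) Ψ
        (fun T hT => subset_closedSpan _ ⟨T, hT, rfl⟩) hb)
  · rw [← compBoth_one_left]
    refine map_mem_of_mem_closedSpan hM
      (compBoth 1 b) ?_ ha
    rintro _ ⟨s, hs, rfl⟩
    rw [compBoth_one_left, ← compBoth_one_right]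
    refine map_mem_of_mem_closedSpan hM
      (compBoth (Φ s) 1) ?_ hb
    rintro _ ⟨t, ht, rfl⟩
    rw [compBoth_one_right]
    exact subset_closedSpan _ ⟨s, subset_closedSpan _ hs, t, subset_closedSpan _ ht, rfl⟩

/-- The range of an operator space on a Hilbert space is total. -/
def IsNondegenerateSpace (P : Submodule ℂ (V →L[ℂ] V)) : Prop :=
  (Submodule.span ℂ {x : V | ∃ a ∈ P, ∃ ξ : V, x = a ξ}).topologicalClosure = ⊤

theorem IsNondegenerateSpace.closedMul {P Q : Submodule ℂ (V →L[ℂ] V)}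
    (hP : IsNondegenerateSpace P) (hQ : IsNondegenerateSpace Q) :
    IsNondegenerateSpace (closedMul P Q) := by
  rw [IsNondegenerateSpace, eq_top_iff, ← hP]
  refine Submodule.topologicalClosure_minimal _ (Submodule.span_le.2 ?_)
    (Submodule.isClosed_topologicalClosure _)
  rintro _ ⟨a, ha, ξ, rfl⟩
  have hξ : ξ ∈ (Submodule.span ℂ {x : V | ∃ a ∈ Q, ∃ ξ : V, x = a ξ}).topologicalClosure := by
    rw [show _ = ⊤ from hQ]; trivial
  refine Submodule.topologicalClosure_minimal (t := Submodule.comap a.toLinearMap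
    (Submodule.span ℂ {x : V | ∃ a ∈ _root_.closedMul P Q, ∃ ξ : V, x = a ξ}).topologicalClosure) _
    (Submodule.span_le.2 ?_)
    ((Submodule.isClosed_topologicalClosure _).preimage a.continuous) hξ
  rintro _ ⟨b, hb, η, rfl⟩
  exact Submodule.le_topologicalClosure _
    (Submodule.subset_span ⟨a * b, mul_mem_closedMul ha hb, η, rfl⟩)

/-! ### Compact operators -/

/-- The compact operators between Hilbert spaces are the closed span of the operators of rank
one. -/
theorem setOf_isCompactOperator_eq_closedSpan_rankOne [CompleteSpace H] [CompleteSpace K] :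
    {T : H →L[ℂ] K | IsCompactOperator T}
      = (closedSpan {T : H →L[ℂ] K | ∃ x y, T = InnerProductSpace.rankOne ℂ x y} :
        Set (H →L[ℂ] K)) := by
  apply Set.Subset.antisymm
  · intro T hT
    refine Metric.mem_closure_iff.2 fun ε hε => ?_
    obtain ⟨C, hC, hTC⟩ := IsCompactOperator.image_closedBall_subset_compact (f := T.toLinearMap)
      hT 1
    obtain ⟨t, -, ht, hCt⟩ := hC.finite_cover_balls (half_pos hε)
    let U := Submodule.span ℂ t
    have : FiniteDimensional ℂ U := FiniteDimensional.span_of_finite ℂ ht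
    refine ⟨U.starProjection.comp T, ?_, ?_⟩
    · rw [OrthonormalBasis.starProjection_eq_sum_rankOne (stdOrthonormalBasis ℂ U),
        ContinuousLinearMap.finsetSum_comp]
      refine Submodule.sum_mem _ fun i _ => Submodule.subset_span
        ⟨stdOrthonormalBasis ℂ U i,
          ContinuousLinearMap.adjoint T (stdOrthonormalBasis ℂ U i), ?_⟩
      ext x
      simp [ContinuousLinearMap.adjoint_inner_left]
    · rw [dist_eq_norm]
      refine lt_of_le_of_lt (ContinuousLinearMap.opNorm_le_of_unit_norm (C := ε / 2)
        (half_pos hε).le fun x hx => ?_) (half_lt_self hε)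
      obtain ⟨y, hy, hxy⟩ := Set.mem_iUnion₂.1
        (hCt (hTC ⟨x, by simp [hx], rfl⟩))
      rw [sub_apply, ContinuousLinearMap.comp_apply,
        Submodule.starProjection_minimal]
      refine (ciInf_le ⟨0, ?_⟩ (⟨y, Submodule.subset_span hy⟩ : U)).trans ?_
      · rintro _ ⟨z, rfl⟩
        exact norm_nonneg _
      · rw [← dist_eq_norm]
        exact (Metric.mem_ball.1 hxy).le
  · refine closedSpan_le (M := compactOperator (RingHom.id ℂ) H K)
      isClosed_setOfPred_isCompactOperator ?_
    rintro _ ⟨x, y, rfl⟩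
    exact (isCompactOperator_of_locallyCompactSpace_dom (innerSL ℂ y)).clm_comp
      (ContinuousLinearMap.toSpanSingleton ℂ x)

end ClosedSpans

/-! ### Slices of operators -/

section Slices

variable {V V₁ V₂ H K : Type*}
  [NormedAddCommGroup V] [InnerProductSpace ℂ V] [CompleteSpace V]
  [NormedAddCommGroup V₁] [InnerProductSpace ℂ V₁] [CompleteSpace V₁]
  [NormedAddCommGroup V₂] [InnerProductSpace ℂ V₂] [CompleteSpace V₂]
  [NormedAddCommGroup H] [InnerProductSpace ℂ H]
  [NormedAddCommGroup K] [InnerProductSpace ℂ K]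

/-- The closed span of the operators `R(η)* W R(ξ)`, for a family of operators `R(ξ) : V → V₁`
which depends linearly on `ξ`. If `V₁ = V ⊗ K` and `R(ξ) v = v ⊗ ξ`, these are the slices of `W`
in the second leg. -/
def sandwich (R : K →L[ℂ] V →L[ℂ] V₁) (W : V₁ →L[ℂ] V₁) : Submodule ℂ (V →L[ℂ] V) :=
  closedSpan {T | ∃ η ξ, T = (ContinuousLinearMap.adjoint (R η)).comp (W.comp (R ξ))}

variable {R : K →L[ℂ] V →L[ℂ] V₁} {W X : V₁ →L[ℂ] V₁}

theorem sandwich_mul_right {U : K → K} (hU : Function.Surjective U)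
    (h : ∀ ξ, X.comp (R ξ) = R (U ξ)) : sandwich R (W * X) = sandwich R W := by
  unfold sandwich
  congr 1
  ext T
  refine exists_congr fun η => Iff.trans ?_ (hU.exists (p := fun ξ =>
    T = (ContinuousLinearMap.adjoint (R η)).comp (W.comp (R ξ)))).symm
  refine exists_congr fun ξ => ?_
  rw [← h ξ]
  rfl

theorem sandwich_mul_left {U : K → K} (hU : Function.Surjective U)
    (h : ∀ ξ, (star X).comp (R ξ) = R (U ξ)) : sandwich R (X * W) = sandwich R W := by
  unfold sandwich
  congr 1
  ext T
  refine Iff.trans ?_ (hU.exists (p := fun η => ∃ ξ,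
    T = (ContinuousLinearMap.adjoint (R η)).comp (W.comp (R ξ)))).symm
  refine exists_congr fun η => exists_congr fun ξ => ?_
  rw [← h η, ContinuousLinearMap.adjoint_comp, ContinuousLinearMap.star_eq_adjoint,
    ContinuousLinearMap.adjoint_adjoint]
  rfl

theorem star_mem_sandwich {T : V →L[ℂ] V} (hT : T ∈ sandwich R W) :
    star T ∈ sandwich R (star W) := by
  refine map_mem_of_mem_closedSpan (isClosed_closedSpan _)
    (starL ℂ : (V →L[ℂ] V) ≃L⋆[ℂ] (V →L[ℂ] V)).toContinuousLinearMap ?_ hT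
  rintro _ ⟨η, ξ, rfl⟩
  refine subset_closedSpan _ ⟨ξ, η, ?_⟩
  simp [ContinuousLinearMap.star_eq_adjoint, ContinuousLinearMap.adjoint_comp,
    ContinuousLinearMap.comp_assoc]

/-- A family of operators which is controlled on elementary tensors only yields the same slices:
elementary tensors are total. -/
theorem sandwich_eq_of_pureTensor {K' : Type*} [NormedAddCommGroup K'] [InnerProductSpace ℂ K']
    {R : HilbTensor K K' →L[ℂ] V →L[ℂ] V₁} :
    sandwich R W = closedSpan {T | ∃ (η : K) (η' : K') (ξ : K) (ξ' : K'),
      T = (ContinuousLinearMap.adjoint (R (pureTensor η η'))).comp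
        (W.comp (R (pureTensor ξ ξ')))} := by
  set M := closedSpan {T | ∃ (η : K) (η' : K') (ξ : K) (ξ' : K'),
      T = (ContinuousLinearMap.adjoint (R (pureTensor η η'))).comp
        (W.comp (R (pureTensor ξ ξ')))} with hM
  refine le_antisymm (closedSpan_le (isClosed_closedSpan _) ?_)
    (closedSpan_le (isClosed_closedSpan _) ?_)
  · rintro _ ⟨σ, τ, rfl⟩
    have h1 : ∀ (η : K) (η' : K'), (ContinuousLinearMap.adjoint (R (pureTensor η η'))).comp
        (W.comp (R τ)) ∈ M := fun η η' => by
      let A := (ContinuousLinearMap.compL ℂ V V₁ V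
        ((ContinuousLinearMap.adjoint (R (pureTensor η η'))).comp W)).comp R
      exact HilbTensor.mem_of_isClosed (S := M.comap A.toLinearMap)
        ((isClosed_closedSpan _).preimage A.continuous)
        (fun ξ ξ' => subset_closedSpan _ ⟨η, η', ξ, ξ', rfl⟩) τ
    -- the bra depends antilinearly on its vector
    let B : HilbTensor K K' →SL[starRingEnd ℂ] (V →L[ℂ] V) :=
      ((ContinuousLinearMap.compL ℂ V V₁ V).flip (W.comp (R τ))).comp
        (ContinuousLinearMap.adjoint.toLinearIsometry.toContinuousLinearMap.comp R)
    exact HilbTensor.mem_of_isClosed (S := M.comap B.toLinearMap)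
      ((isClosed_closedSpan _).preimage B.continuous) h1 σ
  · rintro _ ⟨η, η', ξ, ξ', rfl⟩
    exact subset_closedSpan _ ⟨_, _, rfl⟩

theorem isNondegenerateSpace_sandwich_of_surjective [Nontrivial H]
    {W : HilbTensor V H →L[ℂ] HilbTensor V H}
    (hW : Function.Surjective W) :
    IsNondegenerateSpace (sandwich (rightTensorL V H) W) := by
  obtain ⟨x, hx⟩ := exists_ne (0 : H)
  let N := (Submodule.span ℂ {y : V | ∃ a ∈ sandwich (rightTensorL V H) W, ∃ ξ : V,
    y = a ξ}).topologicalClosure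
  have hN : IsClosed (N : Set V) := Submodule.isClosed_topologicalClosure _
  refine eq_top_iff.2 fun v _ => ?_
  let A := (ContinuousLinearMap.adjoint (rightTensor V x)).comp W
  have hA : ∀ t, A t ∈ N := HilbTensor.mem_of_isClosed (S := N.comap A.toLinearMap)
    (hN.preimage A.continuous) fun w y => Submodule.le_topologicalClosure _
      (Submodule.subset_span ⟨_, subset_closedSpan _ ⟨x, y, rfl⟩, w, rfl⟩)
  obtain ⟨t, ht⟩ := hW (pureTensor v x)
  have h := hA t
  rw [ContinuousLinearMap.comp_apply, ht, adjoint_rightTensor_pureTensor] at h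
  exact (N.smul_mem_iff (inner_self_ne_zero.2 hx)).1 h

end Slices

/-! ### Braided pentagon relations in a group -/

section Words

variable {Γ Γ' : Type*} [Group Γ] [Group Γ']

/-- The relations between the copies `c`, `c'` on the legs 12 and 23 of a braiding, and the copies
`g`, `g'` of `c⁻¹F`, where `F` is a morphism which solves the braided pentagon equation. -/
structure IsBraidedPair (c c' g g' : Γ) : Prop where
  yang_baxter : c * c' * c = c' * c * c'
  naturality_left : c * c' * g = g' * c * c'
  naturality_right : c' * c * g' = g * c' * c
  pentagon : g' * g * g' = g * c'⁻¹ * g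

namespace IsBraidedPair

variable {c c' g g' : Γ}

theorem map (h : IsBraidedPair c c' g g') (φ : Γ →* Γ') :
    IsBraidedPair (φ c) (φ c') (φ g) (φ g') where
  yang_baxter := by simp only [← map_mul, h.yang_baxter]
  naturality_left := by simp only [← map_mul, h.naturality_left]
  naturality_right := by simp only [← map_mul, h.naturality_right]
  pentagon := by simp only [← map_mul, ← map_inv, h.pentagon]

theorem map_eq (h : IsBraidedPair c c' g g') (φ : Γ →* Γ') {d d' e e' : Γ'} (hd : φ c = d)
    (hd' : φ c' = d') (he : φ g = e) (he' : φ g' = e') : IsBraidedPair d d' e e' := by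
  subst hd hd' he he'
  exact h.map φ

/-- Duality: the relations are invariant under passing to inverses. On the level of
multiplicative unitaries, this replaces `F` by `c⁻¹F⁻¹c` and the braiding by its inverse. -/
theorem dual (h : IsBraidedPair c c' g g') : IsBraidedPair c⁻¹ c'⁻¹ g⁻¹ g'⁻¹ where
  yang_baxter := by simpa [mul_assoc] using congrArg (·⁻¹) h.yang_baxter
  naturality_left := by simpa [mul_assoc] using (congrArg (·⁻¹) h.naturality_right).symm
  naturality_right := by simpa [mul_assoc] using (congrArg (·⁻¹) h.naturality_left).symm
  pentagon := by simpa [mul_assoc] using congrArg (·⁻¹) h.pentagon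

/-- The pentagon equation `F₁₂ (c₂₃ F₁₂ c₂₃⁻¹) F₂₃ = F₂₃ F₁₂` in terms of `F = c g`. -/
theorem pentagon' (h : IsBraidedPair c c' g g') :
    (c * g) * c' * (c * g) * g' = (c' * g') * (c * g) := by
  calc (c * g) * c' * (c * g) * g' = c * (g * c' * c) * g * g' := by group
    _ = (c * c' * c) * (g' * g * g') := by rw [← h.naturality_right]; group
    _ = c' * (c * c' * g) * c'⁻¹ * g := by rw [h.pentagon, h.yang_baxter]; group
    _ = (c' * g') * (c * g) := by rw [h.naturality_left]; group

/-- The form of the braided pentagon equation in which `g` is inserted between slices of `F` and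
`F⁻¹`. -/
theorem conj_eq (h : IsBraidedPair c c' g g') :
    (c * g) * g' * (c * g)⁻¹ = c'⁻¹ * ((c * g)⁻¹ * (c' * g')) := by
  calc (c * g) * g' * (c * g)⁻¹
      = c'⁻¹ * (c * g)⁻¹ * ((c * g) * c' * (c * g) * g') * (c * g)⁻¹ := by group
    _ = c'⁻¹ * ((c * g)⁻¹ * (c' * g')) := by rw [h.pentagon']; group

end IsBraidedPair

variable {c₁ c₂ c₃ g₁ g₂ g₃ : Γ}

theorem IsBraidedPair.conj_left (h : IsBraidedPair c₁ c₂ g₁ g₂) :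
    c₁ * (c₂ * g₂) * c₁⁻¹ = c₂⁻¹ * (c₁ * g₁) * c₂ := by
  calc c₁ * (c₂ * g₂) * c₁⁻¹
      = c₂⁻¹ * (c₂ * c₁ * c₂) * g₂ * c₁⁻¹ := by group
    _ = c₂⁻¹ * c₁ * (c₂ * c₁ * g₂) * c₁⁻¹ := by rw [← h.yang_baxter]; group
    _ = c₂⁻¹ * (c₁ * g₁) * c₂ := by rw [h.naturality_right]; group

/-! In the following lemmas, `cᵢ` and `gᵢ` act on the legs `i` and `i + 1` of a fourfold tensor
product. The operators `c₂⁻¹ F₁₂ c₂ = c₁ F₂₃ c₁⁻¹` and `c₂⁻¹ g₂⁻¹ = F̂₂₃` have `Â(F) ⊠ id` and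
`id ⊠ Â(F̂)` as their slices in the third leg. -/

theorem word_left_right (h : IsBraidedPair c₂ c₃ g₂ g₃) :
    (c₂⁻¹ * (c₁ * g₁) * c₂) * c₃ * (c₂⁻¹ * g₂⁻¹)
      = (c₂⁻¹ * (c₁ * g₁) * (c₃⁻¹ * g₃⁻¹) * c₂) * c₃ := by
  have h1 : c₂ * c₃ * (c₂⁻¹ * g₂⁻¹) = c₃⁻¹ * g₃⁻¹ * c₂ * c₃ := by
    calc c₂ * c₃ * (c₂⁻¹ * g₂⁻¹)
        = c₃⁻¹ * (c₃ * c₂ * c₃) * c₂⁻¹ * g₂⁻¹ := by group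
      _ = c₃⁻¹ * g₃⁻¹ * (g₃ * c₂ * c₃) * g₂⁻¹ := by rw [← h.yang_baxter]; group
      _ = c₃⁻¹ * g₃⁻¹ * c₂ * c₃ := by rw [← h.naturality_left]; group
  calc (c₂⁻¹ * (c₁ * g₁) * c₂) * c₃ * (c₂⁻¹ * g₂⁻¹)
      = c₂⁻¹ * (c₁ * g₁) * (c₂ * c₃ * (c₂⁻¹ * g₂⁻¹)) := by group
    _ = _ := by rw [h1]; group

theorem word_right_left (h : IsBraidedPair c₂ c₃ g₂ g₃) (hc : Commute (c₁ * g₁) c₃)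
    (hg : Commute (c₁ * g₁) g₃) :
    (c₂⁻¹ * g₂⁻¹) * c₃⁻¹ * (c₂⁻¹ * (c₁ * g₁) * c₂)
      = c₃⁻¹ * (c₂⁻¹ * (c₁ * g₁) * (c₃⁻¹ * g₃⁻¹) * c₂) := by
  have h1 : c₂⁻¹ * g₂⁻¹ * c₃⁻¹ * c₂⁻¹ = c₃⁻¹ * c₂⁻¹ * c₃⁻¹ * g₃⁻¹ := by
    calc c₂⁻¹ * g₂⁻¹ * c₃⁻¹ * c₂⁻¹ = (c₂ * c₃ * g₂ * c₂)⁻¹ := by group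
      _ = (g₃ * (c₂ * c₃ * c₂))⁻¹ := by rw [h.naturality_left]; group
      _ = c₃⁻¹ * c₂⁻¹ * c₃⁻¹ * g₃⁻¹ := by rw [h.yang_baxter]; group
  have h2 : c₃⁻¹ * g₃⁻¹ * (c₁ * g₁) = (c₁ * g₁) * (c₃⁻¹ * g₃⁻¹) :=
    ((hc.inv_right.mul_right hg.inv_right).eq).symm
  calc (c₂⁻¹ * g₂⁻¹) * c₃⁻¹ * (c₂⁻¹ * (c₁ * g₁) * c₂)
      = (c₂⁻¹ * g₂⁻¹ * c₃⁻¹ * c₂⁻¹) * (c₁ * g₁) * c₂ := by group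
    _ = c₃⁻¹ * c₂⁻¹ * (c₃⁻¹ * g₃⁻¹ * (c₁ * g₁)) * c₂ := by rw [h1]; group
    _ = _ := by rw [h2]; group

theorem word_left_middle_right (h₁ : IsBraidedPair c₁ c₂ g₁ g₂) (h : IsBraidedPair c₂ c₃ g₂ g₃)
    (hg : Commute (c₁ * g₁) g₃) :
    (c₂⁻¹ * (c₁ * g₁) * c₂ * (c₁ * g₁)) * g₃⁻¹ * (c₂⁻¹ * g₂⁻¹)⁻¹
      = g₃⁻¹ * (g₂ * c₃⁻¹ * g₂ * (c₁ * g₁) * c₃ * c₂) * g₃⁻¹ := by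
  have h1 : g₃⁻¹ * g₂ = g₂ * g₃ * g₂⁻¹ * c₃ := by
    calc g₃⁻¹ * g₂ = g₃⁻¹ * (g₂ * c₃⁻¹ * g₂) * g₂⁻¹ * c₃ := by group
      _ = g₂ * g₃ * g₂⁻¹ * c₃ := by rw [← h.pentagon]; group
  have h2 : c₃ * c₂ * g₃⁻¹ = g₂⁻¹ * c₃ * c₂ := by
    calc c₃ * c₂ * g₃⁻¹ = g₂⁻¹ * (g₂ * c₃ * c₂) * g₃⁻¹ := by group
      _ = g₂⁻¹ * c₃ * c₂ := by rw [← h.naturality_right]; group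
  calc (c₂⁻¹ * (c₁ * g₁) * c₂ * (c₁ * g₁)) * g₃⁻¹ * (c₂⁻¹ * g₂⁻¹)⁻¹
      = c₂⁻¹ * (c₁ * g₁) * c₂ * (c₁ * g₁) * (g₃⁻¹ * g₂) * c₂ := by group
    _ = c₂⁻¹ * ((c₁ * g₁) * c₂ * (c₁ * g₁) * g₂) * g₃ * g₂⁻¹ * c₃ * c₂ := by rw [h1]; group
    _ = g₂ * ((c₁ * g₁) * g₃) * (g₂⁻¹ * c₃ * c₂) := by rw [h₁.pentagon']; group
    _ = g₃⁻¹ * (g₃ * g₂ * g₃) * (c₁ * g₁) * (c₃ * c₂ * g₃⁻¹) := by rw [hg.eq, h2]; group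
    _ = _ := by rw [h.pentagon]; group

theorem word_right_left' (h : IsBraidedPair c₂ c₃ g₂ g₃) (hc : Commute (c₁ * g₁) c₃) :
    (c₂⁻¹ * g₂⁻¹)⁻¹ * g₃ * (c₂⁻¹ * (c₁ * g₁) * c₂)
      = g₂ * c₃⁻¹ * g₂ * (c₁ * g₁) * c₃ * c₂ := by
  calc (c₂⁻¹ * g₂⁻¹)⁻¹ * g₃ * (c₂⁻¹ * (c₁ * g₁) * c₂)
      = g₂ * c₃⁻¹ * (c₃ * c₂ * g₃) * c₂⁻¹ * (c₁ * g₁) * c₂ := by group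
    _ = g₂ * c₃⁻¹ * g₂ * (c₃ * (c₁ * g₁)) * c₂ := by rw [h.naturality_right]; group
    _ = _ := by rw [← hc.eq]; group

theorem word_right_left_middle (h₁ : IsBraidedPair c₁ c₂ g₁ g₂) (h : IsBraidedPair c₂ c₃ g₂ g₃)
    (hc : Commute (c₁ * g₁) c₃) (hg : Commute (c₁ * g₁) g₃) :
    (c₂⁻¹ * g₂⁻¹) * g₃ * (c₂⁻¹ * (c₁ * g₁) * c₂ * (c₁ * g₁))
      = g₃ * (c₂⁻¹ * (c₁ * g₁) * c₃⁻¹ * g₃⁻¹ * g₂⁻¹) := by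
  have h1 : c₂⁻¹ * (c₁ * g₁) * c₂ * (c₁ * g₁) = g₂ * (c₁ * g₁) * g₂⁻¹ := by
    calc c₂⁻¹ * (c₁ * g₁) * c₂ * (c₁ * g₁)
        = c₂⁻¹ * ((c₁ * g₁) * c₂ * (c₁ * g₁) * g₂) * g₂⁻¹ := by group
      _ = g₂ * (c₁ * g₁) * g₂⁻¹ := by rw [h₁.pentagon']; group
  have h2 : c₃⁻¹ * g₃⁻¹ * (c₁ * g₁) = (c₁ * g₁) * (c₃⁻¹ * g₃⁻¹) :=
    ((hc.inv_right.mul_right hg.inv_right).eq).symm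
  calc (c₂⁻¹ * g₂⁻¹) * g₃ * (c₂⁻¹ * (c₁ * g₁) * c₂ * (c₁ * g₁))
      = c₂⁻¹ * g₂⁻¹ * (g₃ * g₂ * g₃) * g₃⁻¹ * (c₁ * g₁) * g₂⁻¹ := by rw [h1]; group
    _ = c₂⁻¹ * c₃⁻¹ * (g₂ * c₃ * c₂) * c₂⁻¹ * c₃⁻¹ * g₃⁻¹ * (c₁ * g₁) * g₂⁻¹ := by
        rw [h.pentagon]; group
    _ = g₃ * c₂⁻¹ * (c₃⁻¹ * g₃⁻¹ * (c₁ * g₁)) * g₂⁻¹ := by rw [← h.naturality_right]; group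
    _ = _ := by rw [h2]; group

theorem word_left_right' (h : IsBraidedPair c₂ c₃ g₂ g₃) :
    (c₂⁻¹ * (c₁ * g₁) * c₂) * g₃⁻¹ * (c₂⁻¹ * g₂⁻¹)
      = (c₂⁻¹ * (c₁ * g₁) * c₃⁻¹ * g₃⁻¹ * g₂⁻¹) * g₃⁻¹ := by
  calc (c₂⁻¹ * (c₁ * g₁) * c₂) * g₃⁻¹ * (c₂⁻¹ * g₂⁻¹)
      = c₂⁻¹ * (c₁ * g₁) * c₃⁻¹ * (c₃ * c₂ * g₃ * c₂⁻¹ * c₃⁻¹)⁻¹ * c₃ * g₂⁻¹ := by group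
    _ = c₂⁻¹ * (c₁ * g₁) * c₃⁻¹ * (g₂ * c₃⁻¹ * g₂)⁻¹ := by rw [h.naturality_right]; group
    _ = _ := by rw [← h.pentagon]; group

section Legs

variable {Γ₂ Γ₃ Γ₄ : Type*} [Group Γ₂] [Group Γ₃] [Group Γ₄]
  {leg₁₂ leg₂₃ : Γ₂ →* Γ₃} {leg₁₂₃ : Γ₃ →* Γ₄} {leg₃₄ : Γ₂ →* Γ₄} {c g : Γ₂}

/-! The preceding identities in terms of abstract leg embeddings: the two words in each of the
three theorems agree up to factors in the last two legs. -/

theorem exists_word_comm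
    (h : IsBraidedPair (leg₁₂₃ (leg₂₃ c)) (leg₃₄ c) (leg₁₂₃ (leg₂₃ g)) (leg₃₄ g))
    (hcomm : ∀ X Y, Commute (leg₁₂₃ (leg₁₂ X)) (leg₃₄ Y)) :
    ∃ Z, leg₁₂₃ ((leg₂₃ c)⁻¹ * (leg₁₂ c * leg₁₂ g) * leg₂₃ c) * leg₃₄ c
        * leg₁₂₃ ((leg₂₃ c)⁻¹ * (leg₂₃ g)⁻¹) = Z * leg₃₄ c ∧
      leg₁₂₃ ((leg₂₃ c)⁻¹ * (leg₂₃ g)⁻¹) * leg₃₄ c⁻¹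
        * leg₁₂₃ ((leg₂₃ c)⁻¹ * (leg₁₂ c * leg₁₂ g) * leg₂₃ c) = leg₃₄ c⁻¹ * Z := by
  simp only [map_mul, map_inv]
  exact ⟨_, word_left_right h, word_right_left h ((hcomm c c).mul_left (hcomm g c))
    ((hcomm c g).mul_left (hcomm g g))⟩

theorem exists_word_left_mul (h₁ : IsBraidedPair (leg₁₂ c) (leg₂₃ c) (leg₁₂ g) (leg₂₃ g))
    (h : IsBraidedPair (leg₁₂₃ (leg₂₃ c)) (leg₃₄ c) (leg₁₂₃ (leg₂₃ g)) (leg₃₄ g))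
    (hcomm : ∀ X Y, Commute (leg₁₂₃ (leg₁₂ X)) (leg₃₄ Y)) :
    ∃ Z, leg₁₂₃ ((leg₂₃ c)⁻¹ * (leg₁₂ c * leg₁₂ g) * leg₂₃ c * leg₁₂ (c * g)) * leg₃₄ g⁻¹
        * leg₁₂₃ ((leg₂₃ c)⁻¹ * (leg₂₃ g)⁻¹)⁻¹ = leg₃₄ g⁻¹ * Z * leg₃₄ g⁻¹ ∧
      leg₁₂₃ ((leg₂₃ c)⁻¹ * (leg₂₃ g)⁻¹)⁻¹ * leg₃₄ g
        * leg₁₂₃ ((leg₂₃ c)⁻¹ * (leg₁₂ c * leg₁₂ g) * leg₂₃ c) = Z := by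
  have h₁' := h₁.map leg₁₂₃
  simp only [map_mul, map_inv]
  exact ⟨_, word_left_middle_right h₁' h ((hcomm c g).mul_left (hcomm g g)),
    word_right_left' h ((hcomm c c).mul_left (hcomm g c))⟩

theorem exists_word_right_mul (h₁ : IsBraidedPair (leg₁₂ c) (leg₂₃ c) (leg₁₂ g) (leg₂₃ g))
    (h : IsBraidedPair (leg₁₂₃ (leg₂₃ c)) (leg₃₄ c) (leg₁₂₃ (leg₂₃ g)) (leg₃₄ g))
    (hcomm : ∀ X Y, Commute (leg₁₂₃ (leg₁₂ X)) (leg₃₄ Y)) :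
    ∃ Z, leg₁₂₃ ((leg₂₃ c)⁻¹ * (leg₂₃ g)⁻¹) * leg₃₄ g
        * leg₁₂₃ ((leg₂₃ c)⁻¹ * (leg₁₂ c * leg₁₂ g) * leg₂₃ c * leg₁₂ (c * g))
          = leg₃₄ g * Z ∧
      leg₁₂₃ ((leg₂₃ c)⁻¹ * (leg₁₂ c * leg₁₂ g) * leg₂₃ c) * leg₃₄ g⁻¹
        * leg₁₂₃ ((leg₂₃ c)⁻¹ * (leg₂₃ g)⁻¹) = Z * leg₃₄ g⁻¹ := by
  have h₁' := h₁.map leg₁₂₃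
  simp only [map_mul, map_inv]
  exact ⟨_, word_right_left_middle h₁' h ((hcomm c c).mul_left (hcomm g c))
    ((hcomm c g).mul_left (hcomm g g)), word_left_right' h⟩

end Legs

end Words

/-! ### Insertion of a regular operator between slices -/

section Insertion

variable {V V₁ V₂ H : Type*}
  [NormedAddCommGroup V] [InnerProductSpace ℂ V] [CompleteSpace V]
  [NormedAddCommGroup V₁] [InnerProductSpace ℂ V₁] [CompleteSpace V₁]
  [NormedAddCommGroup V₂] [InnerProductSpace ℂ V₂] [CompleteSpace V₂]
  [NormedAddCommGroup H] [InnerProductSpace ℂ H] [CompleteSpace H]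

theorem slice_vectorFunctional (X : HilbTensor H H →L[ℂ] HilbTensor H H) (ζ ζ' : H) :
    slice (vectorFunctional ζ ζ') X
      = (ContinuousLinearMap.adjoint (rightTensor H ζ)).comp (X.comp (rightTensor H ζ')) := by
  ext ξ
  refine ext_inner_left ℂ fun η => ?_
  rw [inner_slice, ContinuousLinearMap.comp_apply, ContinuousLinearMap.adjoint_inner_right]
  change ⟪ζ, innerLeg X η ξ ζ'⟫_ℂ = _
  rw [innerLeg, ContinuousLinearMap.comp_apply, ContinuousLinearMap.adjoint_inner_right]
  rfl

/-- The slice `(id ⊗ ω)(X)` as a bounded linear function of `ω`. -/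
def sliceL (X : HilbTensor H H →L[ℂ] HilbTensor H H) :
    StrongDual ℂ (H →L[ℂ] H) →L[ℂ] (H →L[ℂ] H) :=
  LinearMap.mkContinuous
    { toFun := fun ω => slice ω X
      map_add' := fun ω ω' => by
        ext ξ
        refine ext_inner_left ℂ fun η => ?_
        rw [add_apply, inner_add_right, inner_slice, inner_slice, inner_slice, add_apply]
      map_smul' := fun c ω => by
        ext ξ
        refine ext_inner_left ℂ fun η => ?_
        rw [RingHom.id_apply, smul_apply, inner_smul_right, inner_slice, inner_slice, smul_apply,
          smul_eq_mul] }
    ‖X‖ fun ω => by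
      refine ContinuousLinearMap.opNorm_le_bound _ (by positivity) fun ξ => ?_
      have h1 : ‖slice ω X ξ‖ = ‖sliceForm ω X ξ‖ :=
        (InnerProductSpace.toDual ℂ H).symm.norm_map _
      have h2 : ‖sliceForm ω X‖ ≤ ‖ω‖ * ‖X‖ := LinearMap.mkContinuous₂_norm_le _ (by positivity) _
      calc ‖slice ω X ξ‖ ≤ ‖sliceForm ω X‖ * ‖ξ‖ := h1 ▸ (sliceForm ω X).le_opNorm ξ
        _ ≤ ‖X‖ * ‖ω‖ * ‖ξ‖ := by
          rw [mul_comm ‖X‖]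
          exact mul_le_mul_of_nonneg_right h2 (norm_nonneg _)

theorem sliceSpace_eq_sandwich (X : HilbTensor H H →L[ℂ] HilbTensor H H) :
    sliceSpace X = sandwich (rightTensorL H H) X := by
  refine le_antisymm (closedSpan_le (isClosed_closedSpan _) ?_)
    (closedSpan_le (isClosed_closedSpan _) ?_)
  · rintro _ ⟨ω, hω, rfl⟩
    refine Submodule.topologicalClosure_minimal
      (t := (sandwich (rightTensorL H H) X).comap (sliceL X).toLinearMap) _
      (Submodule.span_le.2 ?_)
      ((isClosed_closedSpan _).preimage (sliceL X).continuous) hω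
    rintro _ ⟨η, ξ, rfl⟩
    exact subset_closedSpan _ ⟨η, ξ, slice_vectorFunctional X η ξ⟩
  · rintro _ ⟨η, ξ, rfl⟩
    exact subset_closedSpan _ ⟨vectorFunctional η ξ,
      Submodule.le_topologicalClosure _ (Submodule.subset_span ⟨η, ξ, rfl⟩),
      (slice_vectorFunctional X η ξ).symm⟩

/-- If the slices of `Y` span the compact operators, then a product of two slices, in which the
operator `|ξ⟩⟨η|` of rank one occurs, may be replaced by a slice of a product with `Y` in the
middle. -/
theorem closedMul_sandwich_sandwich {R : H →L[ℂ] V →L[ℂ] V₁} {R' : H →L[ℂ] V₁ →L[ℂ] V₂}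
    {RR : HilbTensor H H →L[ℂ] V →L[ℂ] V₂}
    (hRR : ∀ ξ ξ', RR (pureTensor ξ ξ') = (R' ξ').comp (R ξ))
    (j : (H →L[ℂ] H) →L[ℂ] (V₁ →L[ℂ] V₁))
    (hj : ∀ ξ η, j (InnerProductSpace.rankOne ℂ ξ η)
      = (R ξ).comp (ContinuousLinearMap.adjoint (R η)))
    {Y : HilbTensor H H →L[ℂ] HilbTensor H H} {Y' : V₂ →L[ℂ] V₂}
    (hY' : ∀ η ξ, (ContinuousLinearMap.adjoint (R' η)).comp (Y'.comp (R' ξ))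
      = j (slice (vectorFunctional η ξ) Y))
    (hY : (sliceSpace Y : Set (H →L[ℂ] H)) = {T : H →L[ℂ] H | IsCompactOperator T})
    {W₁ W₂ : V₁ →L[ℂ] V₁} {W₁' W₂' : V₂ →L[ℂ] V₂}
    (hW₁ : ∀ η, (ContinuousLinearMap.adjoint (R' η)).comp W₁'
      = W₁.comp (ContinuousLinearMap.adjoint (R' η)))
    (hW₂ : ∀ ξ, W₂'.comp (R' ξ) = (R' ξ).comp W₂) :
    closedMul (sandwich R W₁) (sandwich R W₂) = sandwich RR (W₁' * Y' * W₂') := by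
  have hY₂ : sandwich (rightTensorL H H) Y
      = closedSpan {T | ∃ x y, T = InnerProductSpace.rankOne ℂ x y} := by
    apply SetLike.coe_injective
    rw [← sliceSpace_eq_sandwich, hY, setOf_isCompactOperator_eq_closedSpan_rankOne]
  let Φ (η ξ : H) : (H →L[ℂ] H) →L[ℂ] (V →L[ℂ] V) :=
    (compBoth ((ContinuousLinearMap.adjoint (R η)).comp W₁) (W₂.comp (R ξ))).comp j
  -- a sandwich with two-legged vectors is a sandwich with a slice of `Y` in the middle
  have key : ∀ η η' ξ ξ', (ContinuousLinearMap.adjoint (RR (pureTensor η η'))).comp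
      ((W₁' * Y' * W₂').comp (RR (pureTensor ξ ξ'))) = Φ η ξ (slice (vectorFunctional η' ξ') Y) := by
    intro η η' ξ ξ'
    rw [hRR, hRR, ContinuousLinearMap.adjoint_comp]
    change _ = ((ContinuousLinearMap.adjoint (R η)).comp W₁).comp
      ((j (slice (vectorFunctional η' ξ') Y)).comp (W₂.comp (R ξ)))
    rw [← hY']
    calc _ = (ContinuousLinearMap.adjoint (R η)).comp
          (((ContinuousLinearMap.adjoint (R' η')).comp W₁').comp
            (Y'.comp ((W₂'.comp (R' ξ')).comp (R ξ)))) := rfl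
      _ = _ := by rw [hW₁, hW₂]; rfl
  rw [sandwich_eq_of_pureTensor]
  refine le_antisymm ?_ (closedSpan_le (isClosed_closedMul _ _) ?_)
  · have hM := isClosed_closedSpan {T | ∃ (η η' ξ ξ' : H),
      T = (ContinuousLinearMap.adjoint (RR (pureTensor η η'))).comp
        ((W₁' * Y' * W₂').comp (RR (pureTensor ξ ξ')))}
    refine closedMul_le hM fun a ha b hb => ?_
    rw [← compBoth_one_left]
    refine map_mem_of_mem_closedSpan hM (compBoth 1 b) ?_ ha
    rintro _ ⟨η, ξ, rfl⟩
    rw [compBoth_one_left, ← compBoth_one_right]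
    refine map_mem_of_mem_closedSpan hM (compBoth _ 1) ?_ hb
    rintro _ ⟨η', ξ', rfl⟩
    rw [compBoth_one_right]
    have h1 : ((ContinuousLinearMap.adjoint (R η)).comp (W₁.comp (R ξ))) *
        ((ContinuousLinearMap.adjoint (R η')).comp (W₂.comp (R ξ')))
        = Φ η ξ' (InnerProductSpace.rankOne ℂ ξ η') := by
      change _ = ((ContinuousLinearMap.adjoint (R η)).comp W₁).comp
        ((j (InnerProductSpace.rankOne ℂ ξ η')).comp (W₂.comp (R ξ')))
      rw [hj]
      rfl
    rw [h1]
    have h2 : InnerProductSpace.rankOne ℂ ξ η' ∈ sandwich (rightTensorL H H) Y := by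
      rw [hY₂]
      exact subset_closedSpan _ ⟨ξ, η', rfl⟩
    refine map_mem_of_mem_closedSpan hM (Φ η ξ') ?_ h2
    rintro _ ⟨ζ, ζ', rfl⟩
    exact subset_closedSpan _ ⟨η, ζ, ξ', ζ', by
      rw [key, slice_vectorFunctional]; rfl⟩
  · rintro _ ⟨η, η', ξ, ξ', rfl⟩
    rw [key]
    have h2 : slice (vectorFunctional η' ξ') Y
        ∈ closedSpan {T : H →L[ℂ] H | ∃ x y, T = InnerProductSpace.rankOne ℂ x y} := by
      rw [← hY₂, slice_vectorFunctional]
      exact subset_closedSpan _ ⟨η', ξ', rfl⟩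
    refine map_mem_of_mem_closedSpan (isClosed_closedMul (sandwich R W₁) (sandwich R W₂))
      (Φ η ξ) ?_ h2
    rintro _ ⟨x, y, rfl⟩
    have h1 : Φ η ξ (InnerProductSpace.rankOne ℂ x y)
        = ((ContinuousLinearMap.adjoint (R η)).comp (W₁.comp (R x))) *
        ((ContinuousLinearMap.adjoint (R y)).comp (W₂.comp (R ξ))) := by
      change ((ContinuousLinearMap.adjoint (R η)).comp W₁).comp
        ((j (InnerProductSpace.rankOne ℂ x y)).comp (W₂.comp (R ξ))) = _
      rw [hj]
      rfl
    rw [h1]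
    exact mul_mem_closedMul (subset_closedSpan _ ⟨η, x, rfl⟩) (subset_closedSpan _ ⟨y, ξ, rfl⟩)

end Insertion

/-! ### Slices in the last legs -/

section LastLegs

variable {V H : Type*}
  [NormedAddCommGroup V] [InnerProductSpace ℂ V] [CompleteSpace V]
  [NormedAddCommGroup H] [InnerProductSpace ℂ H] [CompleteSpace H]

variable (V H) in
/-- `σ ↦ (v ↦ v ⊗ σ)` for `σ ∈ H ⊗ H`, with values in `(V ⊗ H) ⊗ H`. -/
def rightTensorTwoL : HilbTensor H H →L[ℂ] V →L[ℂ] HilbTensor (HilbTensor V H) H :=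
  (ContinuousLinearMap.compL ℂ V (HilbTensor V (HilbTensor H H)) (HilbTensor (HilbTensor V H) H)
    (HilbTensor.assoc V H H).symm.toContinuousLinearEquiv.toContinuousLinearMap).comp
    (rightTensorL V (HilbTensor H H))

theorem rightTensorTwoL_apply (σ : HilbTensor H H) (v : V) :
    rightTensorTwoL V H σ v = (HilbTensor.assoc V H H).symm (pureTensor v σ) := rfl

theorem rightTensorTwoL_pureTensor (x y : H) :
    rightTensorTwoL V H (pureTensor x y)
      = (rightTensorL (HilbTensor V H) H y).comp (rightTensorL V H x) := by
  ext v
  exact HilbTensor.assoc_symm_pureTensor v x y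

theorem lastTwo_comp_rightTensorTwoL (X : HilbTensor H H →L[ℂ] HilbTensor H H)
    (σ : HilbTensor H H) :
    (lastTwo V H H X).comp (rightTensorTwoL V H σ) = rightTensorTwoL V H (X σ) := by
  ext v
  rw [ContinuousLinearMap.comp_apply, lastTwo_apply, rightTensorTwoL_apply,
    LinearIsometryEquiv.apply_symm_apply, idTensor_pureTensor, rightTensorTwoL_apply]

omit [CompleteSpace V] [CompleteSpace H] in
theorem tensorId_comp_rightTensorL (W : V →L[ℂ] V) (x : H) :
    (tensorId H W).comp (rightTensorL V H x) = (rightTensorL V H x).comp W := by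
  ext v
  exact tensorId_pureTensor W v x

omit [CompleteSpace H] in
theorem adjoint_rightTensorL_comp_tensorId (W : V →L[ℂ] V) (x : H) :
    (ContinuousLinearMap.adjoint (rightTensorL V H x)).comp (tensorId H W)
      = W.comp (ContinuousLinearMap.adjoint (rightTensorL V H x)) := by
  refine HilbTensor.ext_clm fun v y => ?_
  simp [rightTensorL_apply, adjoint_rightTensor_pureTensor]

omit [CompleteSpace H] in
theorem idTensor_rankOne (x y : H) :
    idTensor V (InnerProductSpace.rankOne ℂ x y)
      = (rightTensorL V H x).comp (ContinuousLinearMap.adjoint (rightTensorL V H y)) := by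
  refine HilbTensor.ext_clm fun v z => ?_
  rw [idTensor_pureTensor, ContinuousLinearMap.comp_apply, rightTensorL_apply, rightTensorL_apply,
    adjoint_rightTensor_pureTensor, map_smul, rightTensor_apply,
    InnerProductSpace.rankOne_apply, pureTensor_smul_right]

theorem adjoint_rightTensorL_comp_lastTwo (Y : HilbTensor H H →L[ℂ] HilbTensor H H) (x y : H) :
    (ContinuousLinearMap.adjoint (rightTensorL (HilbTensor V H) H x)).comp
        ((lastTwo V H H Y).comp (rightTensorL (HilbTensor V H) H y))
      = idTensor V ((ContinuousLinearMap.adjoint (rightTensorL H H x)).comp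
        (Y.comp (rightTensorL H H y))) := by
  refine HilbTensor.ext_clm fun v z => ?_
  have h : ((ContinuousLinearMap.adjoint (rightTensorL (HilbTensor V H) H x)).comp
      (HilbTensor.assoc V H H).symm.toContinuousLinearEquiv.toContinuousLinearMap).comp
        (leftTensor V _ v)
      = (leftTensor V _ v).comp (ContinuousLinearMap.adjoint (rightTensorL H H x)) := by
    refine HilbTensor.ext_clm fun y z => ?_
    simp only [ContinuousLinearMap.comp_apply, leftTensor_apply, rightTensorL_apply,
      adjoint_rightTensor_pureTensor, ContinuousLinearEquiv.coe_coe,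
      LinearIsometryEquiv.coe_toContinuousLinearEquiv, HilbTensor.assoc_symm_pureTensor,
      pureTensor_smul_right]
  have h2 := congrArg (fun f => f (Y (pureTensor z y))) h
  rw [idTensor_pureTensor]
  refine Eq.trans ?_ h2
  simp only [ContinuousLinearMap.comp_apply, rightTensorL_apply, rightTensor_apply,
    lastTwo_pureTensor]
  rfl

/-- The slices of `X Y₂₃ Z`, where `X` and `Z` do not act on the last leg. -/
theorem sandwich_tensorId_mul_lastTwo_mul_tensorId (X Z : HilbTensor V H →L[ℂ] HilbTensor V H)
    (Y : HilbTensor H H →L[ℂ] HilbTensor H H) :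
    sandwich (rightTensorL (HilbTensor V H) H) (tensorId H X * lastTwo V H H Y * tensorId H Z)
      = closedSpan ((compBoth X Z).comp (idTensorL V H H) ''
        {T | ∃ η ξ, T = (ContinuousLinearMap.adjoint (rightTensorL H H η)).comp
          (Y.comp (rightTensorL H H ξ))}) := by
  have key : ∀ η ξ, (ContinuousLinearMap.adjoint (rightTensorL (HilbTensor V H) H η)).comp
      ((tensorId H X * lastTwo V H H Y * tensorId H Z).comp
        (rightTensorL (HilbTensor V H) H ξ))
      = (compBoth X Z).comp (idTensorL V H H)
        ((ContinuousLinearMap.adjoint (rightTensorL H H η)).comp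
          (Y.comp (rightTensorL H H ξ))) := by
    intro η ξ
    calc _ = ((ContinuousLinearMap.adjoint (rightTensorL (HilbTensor V H) H η)).comp
          (tensorId H X)).comp ((lastTwo V H H Y).comp
            ((tensorId H Z).comp (rightTensorL (HilbTensor V H) H ξ))) := rfl
      _ = X.comp (((ContinuousLinearMap.adjoint (rightTensorL (HilbTensor V H) H η)).comp
          ((lastTwo V H H Y).comp (rightTensorL (HilbTensor V H) H ξ))).comp Z) := by
        rw [adjoint_rightTensorL_comp_tensorId, tensorId_comp_rightTensorL]
        rfl
      _ = _ := by
        rw [adjoint_rightTensorL_comp_lastTwo]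
        rfl
  unfold sandwich
  congr 1
  ext T
  constructor
  · rintro ⟨η, ξ, rfl⟩
    exact ⟨_, ⟨η, ξ, rfl⟩, (key η ξ).symm⟩
  · rintro ⟨_, ⟨η, ξ, rfl⟩, rfl⟩
    exact ⟨η, ξ, (key η ξ).symm⟩

/-- The closed product of two spaces of slices as a space of slices in one leg more, with a
regular operator `Y` inserted on the last two legs. -/
theorem closedMul_slices {Y : HilbTensor H H →L[ℂ] HilbTensor H H}
    (hY : (sliceSpace Y : Set (H →L[ℂ] H)) = {T : H →L[ℂ] H | IsCompactOperator T})
    (W₁ W₂ : HilbTensor V H →L[ℂ] HilbTensor V H) :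
    closedMul (sandwich (rightTensorL V H) W₁) (sandwich (rightTensorL V H) W₂)
      = sandwich (rightTensorTwoL V H) (tensorId H W₁ * lastTwo V H H Y * tensorId H W₂) := by
  have hY' : ∀ η ξ, (ContinuousLinearMap.adjoint (rightTensorL (HilbTensor V H) H η)).comp
      ((lastTwo V H H Y).comp (rightTensorL (HilbTensor V H) H ξ))
      = idTensorL V H H (slice (vectorFunctional η ξ) Y) := fun η ξ => by
    rw [adjoint_rightTensorL_comp_lastTwo, slice_vectorFunctional, idTensorL_apply]
    rfl
  have hj : ∀ ξ η : H, idTensorL V H H (InnerProductSpace.rankOne ℂ ξ η)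
      = (rightTensorL V H ξ).comp (ContinuousLinearMap.adjoint (rightTensorL V H η)) :=
    idTensor_rankOne
  have hW₁ := fun η : H => adjoint_rightTensorL_comp_tensorId W₁ η
  have hW₂ := fun ξ : H => tensorId_comp_rightTensorL W₂ ξ
  exact closedMul_sandwich_sandwich (R := rightTensorL V H)
    (R' := rightTensorL (HilbTensor V H) H) (RR := rightTensorTwoL V H)
    (fun x y => rightTensorTwoL_pureTensor x y) (idTensorL V H H) hj hY' hY hW₁ hW₂

theorem sandwich_mul_lastTwo (W : HilbTensor (HilbTensor V H) H →L[ℂ] HilbTensor (HilbTensor V H) H)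
    (X : (HilbTensor H H →L[ℂ] HilbTensor H H)ˣ) :
    sandwich (rightTensorTwoL V H) (W * lastTwo V H H X) = sandwich (rightTensorTwoL V H) W :=
  sandwich_mul_right (U := (X : HilbTensor H H →L[ℂ] HilbTensor H H))
    (fun σ => ⟨(↑X⁻¹ : HilbTensor H H →L[ℂ] HilbTensor H H) σ,
      congrArg (fun f => f σ) X.mul_inv⟩)
    (lastTwo_comp_rightTensorTwoL _)

theorem sandwich_lastTwo_mul (W : HilbTensor (HilbTensor V H) H →L[ℂ] HilbTensor (HilbTensor V H) H)
    (X : (HilbTensor H H →L[ℂ] HilbTensor H H)ˣ) :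
    sandwich (rightTensorTwoL V H) (lastTwo V H H X * W) = sandwich (rightTensorTwoL V H) W :=
  sandwich_mul_left (U := (↑(star X) : HilbTensor H H →L[ℂ] HilbTensor H H))
    (fun σ => ⟨(↑(star X)⁻¹ : HilbTensor H H →L[ℂ] HilbTensor H H) σ,
      congrArg (fun f => f σ) (star X).mul_inv⟩)
    (fun σ => by
      rw [star_lastTwo]
      exact lastTwo_comp_rightTensorTwoL _ σ)

theorem sandwich_tensorId [Nontrivial H] (W : HilbTensor V H →L[ℂ] HilbTensor V H) :
    sandwich (rightTensorTwoL V H) (tensorId H W) = sandwich (rightTensorL V H) W := by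
  have key : ∀ η η' ξ ξ' : H, (ContinuousLinearMap.adjoint
        (rightTensorTwoL V H (pureTensor η η'))).comp
        ((tensorId H W).comp (rightTensorTwoL V H (pureTensor ξ ξ')))
      = ⟪η', ξ'⟫_ℂ • (ContinuousLinearMap.adjoint (rightTensorL V H η)).comp
        (W.comp (rightTensorL V H ξ)) := by
    intro η η' ξ ξ'
    rw [rightTensorTwoL_pureTensor, rightTensorTwoL_pureTensor, ContinuousLinearMap.adjoint_comp]
    calc _ = (ContinuousLinearMap.adjoint (rightTensorL V H η)).comp
          (((ContinuousLinearMap.adjoint (rightTensorL (HilbTensor V H) H η')).comp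
            ((tensorId H W).comp (rightTensorL (HilbTensor V H) H ξ'))).comp
            (rightTensorL V H ξ)) := rfl
      _ = _ := by
        rw [tensorId_comp_rightTensorL, ← ContinuousLinearMap.comp_assoc
          (ContinuousLinearMap.adjoint (rightTensorL (HilbTensor V H) H η')),
          rightTensorL_apply (V := HilbTensor V H) η', rightTensorL_apply (V := HilbTensor V H) ξ',
          adjoint_rightTensor_comp_rightTensor]
        ext v
        simp
  rw [sandwich_eq_of_pureTensor]
  refine le_antisymm (closedSpan_le (isClosed_closedSpan _) ?_)
    (closedSpan_le (isClosed_closedSpan _) ?_)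
  · rintro _ ⟨η, η', ξ, ξ', rfl⟩
    rw [key]
    exact Submodule.smul_mem _ _ (subset_closedSpan _ ⟨η, ξ, rfl⟩)
  · rintro _ ⟨η, ξ, rfl⟩
    obtain ⟨x, hx⟩ := exists_ne (0 : H)
    have hx' : ⟪x, x⟫_ℂ ≠ 0 := inner_self_ne_zero.2 hx
    rw [← inv_smul_smul₀ hx' ((ContinuousLinearMap.adjoint (rightTensorL V H η)).comp
        (W.comp (rightTensorL V H ξ))), ← key]
    exact Submodule.smul_mem _ _ (subset_closedSpan _ ⟨η, x, ξ, x, rfl⟩)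

end LastLegs

/-! ### Regular braided multiplicative unitaries on a Hilbert space -/

section Hilbert

variable {H : Type*} [NormedAddCommGroup H] [InnerProductSpace ℂ H] [CompleteSpace H]

variable (H) in
/-- The operators on `H ⊗ H`, acting on the legs 12 of `(H ⊗ H) ⊗ H`. -/
def leg₁₂ : (HilbTensor H H →L[ℂ] HilbTensor H H)ˣ →*
    (HilbTensor (HilbTensor H H) H →L[ℂ] HilbTensor (HilbTensor H H) H)ˣ :=
  Units.map (tensorIdHom (HilbTensor H H) H)

variable (H) in
/-- The operators on `H ⊗ H`, acting on the legs 23 of `(H ⊗ H) ⊗ H`. -/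
def leg₂₃ : (HilbTensor H H →L[ℂ] HilbTensor H H)ˣ →*
    (HilbTensor (HilbTensor H H) H →L[ℂ] HilbTensor (HilbTensor H H) H)ˣ :=
  Units.map (lastTwo H H H)

variable (H) in
/-- The operators on `(H ⊗ H) ⊗ H`, acting on the first three legs of `((H ⊗ H) ⊗ H) ⊗ H`. -/
def leg₁₂₃ : (HilbTensor (HilbTensor H H) H →L[ℂ] HilbTensor (HilbTensor H H) H)ˣ →*
    (HilbTensor (HilbTensor (HilbTensor H H) H) H →L[ℂ]
      HilbTensor (HilbTensor (HilbTensor H H) H) H)ˣ :=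
  Units.map (tensorIdHom (HilbTensor (HilbTensor H H) H) H)

variable (H) in
/-- The operators on `H ⊗ H`, acting on the last two legs of `((H ⊗ H) ⊗ H) ⊗ H`. -/
def leg₃₄ : (HilbTensor H H →L[ℂ] HilbTensor H H)ˣ →*
    (HilbTensor (HilbTensor (HilbTensor H H) H) H →L[ℂ]
      HilbTensor (HilbTensor (HilbTensor H H) H) H)ˣ :=
  Units.map (lastTwo (HilbTensor H H) H H)

/-- A unitary braid operator `c` on `H ⊗ H` and a unitary `g = c⁻¹F`, where `F` is a unitary which
is natural with respect to `c` and solves the braided pentagon equation, such that `c` and `F` are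
regular. -/
structure IsRegularPair (c g : (HilbTensor H H →L[ℂ] HilbTensor H H)ˣ) : Prop where
  star_braid : star c = c⁻¹
  star_unitary : star g = g⁻¹
  relations : IsBraidedPair (leg₁₂ H c) (leg₂₃ H c) (leg₁₂ H g) (leg₂₃ H g)
  regular_braid : (sliceSpace (c : HilbTensor H H →L[ℂ] HilbTensor H H) : Set (H →L[ℂ] H))
    = {T : H →L[ℂ] H | IsCompactOperator T}
  regular_unitary : (sliceSpace (g : HilbTensor H H →L[ℂ] HilbTensor H H) : Set (H →L[ℂ] H))
    = {T : H →L[ℂ] H | IsCompactOperator T}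

theorem star_mem_closedSpan_rankOne {T : H →L[ℂ] H}
    (hT : T ∈ closedSpan {T : H →L[ℂ] H | ∃ x y, T = InnerProductSpace.rankOne ℂ x y}) :
    star T ∈ closedSpan {T : H →L[ℂ] H | ∃ x y, T = InnerProductSpace.rankOne ℂ x y} := by
  refine map_mem_of_mem_closedSpan (isClosed_closedSpan _)
    (starL ℂ : (H →L[ℂ] H) ≃L⋆[ℂ] (H →L[ℂ] H)).toContinuousLinearMap ?_ hT
  rintro _ ⟨x, y, rfl⟩
  exact subset_closedSpan _ ⟨y, x, InnerProductSpace.adjoint_rankOne x y⟩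

theorem sliceSpace_star_eq_compact {X : HilbTensor H H →L[ℂ] HilbTensor H H}
    (hX : (sliceSpace X : Set (H →L[ℂ] H)) = {T : H →L[ℂ] H | IsCompactOperator T}) :
    (sliceSpace (star X) : Set (H →L[ℂ] H)) = {T : H →L[ℂ] H | IsCompactOperator T} := by
  rw [setOf_isCompactOperator_eq_closedSpan_rankOne, SetLike.coe_set_eq,
    sliceSpace_eq_sandwich] at hX ⊢
  refine le_antisymm (fun T hT => ?_) (fun T hT => ?_)
  · have h := star_mem_sandwich hT
    rw [star_star, hX] at h
    simpa using star_mem_closedSpan_rankOne h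
  · have h := star_mem_closedSpan_rankOne hT
    rw [← hX] at h
    simpa using star_mem_sandwich h

namespace IsRegularPair

variable {c g : (HilbTensor H H →L[ℂ] HilbTensor H H)ˣ}

theorem dual (h : IsRegularPair c g) : IsRegularPair c⁻¹ g⁻¹ where
  star_braid := by rw [star_inv, h.star_braid]
  star_unitary := by rw [star_inv, h.star_unitary]
  relations := by
    simpa only [map_inv] using h.relations.dual
  regular_braid := by
    rw [← h.star_braid]
    exact sliceSpace_star_eq_compact h.regular_braid
  regular_unitary := by
    rw [← h.star_unitary]
    exact sliceSpace_star_eq_compact h.regular_unitary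

theorem star_mul (h : IsRegularPair c g) : star (c * g) = (c * g)⁻¹ := by
  rw [StarMul.star_mul, h.star_braid, h.star_unitary, mul_inv_rev]

/-- `Â(F) Â(F)* = Â(F)*` by the braided pentagon equation and the regularity of `F`. -/
theorem closedMul_star [Nontrivial H] (h : IsRegularPair c g) :
    closedMul (sandwich (rightTensorL H H) ↑(c * g)) (sandwich (rightTensorL H H) ↑(c * g)⁻¹)
      = sandwich (rightTensorL H H) ↑(c * g)⁻¹ := by
  rw [closedMul_slices h.regular_unitary]
  have hw : leg₁₂ H (c * g) * leg₂₃ H g * leg₁₂ H (c * g)⁻¹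
      = leg₂₃ H c⁻¹ * (leg₁₂ H (c * g)⁻¹ * leg₂₃ H (c * g)) := by
    simpa only [map_mul, map_inv] using h.relations.conj_eq
  have hw' : tensorId H (↑(c * g) : HilbTensor H H →L[ℂ] HilbTensor H H) * lastTwo H H H ↑g
      * tensorId H ↑(c * g)⁻¹ = lastTwo H H H ↑c⁻¹ * (tensorId H ↑(c * g)⁻¹ *
        lastTwo H H H ↑(c * g)) := congrArg Units.val hw
  rw [hw', sandwich_lastTwo_mul, sandwich_mul_lastTwo, sandwich_tensorId]

/-- `Â(F)` is selfadjoint: taking adjoints in `Â(F) Â(F)* = Â(F)*` gives `Â(F) = Â(F) Â(F)*`. -/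
theorem sandwich_inv [Nontrivial H] (h : IsRegularPair c g) :
    sandwich (rightTensorL H H) (↑(c * g)⁻¹ : HilbTensor H H →L[ℂ] HilbTensor H H)
      = sandwich (rightTensorL H H) ↑(c * g) := by
  have hs : star (↑(c * g) : HilbTensor H H →L[ℂ] HilbTensor H H) = ↑(c * g)⁻¹ :=
    congrArg Units.val h.star_mul
  have hs' : star (↑(c * g)⁻¹ : HilbTensor H H →L[ℂ] HilbTensor H H) = ↑(c * g) :=
    congrArg Units.val (show star (c * g)⁻¹ = c * g by rw [star_inv, h.star_mul, inv_inv])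
  have h1 : ∀ a ∈ sandwich (rightTensorL H H) (↑(c * g) : HilbTensor H H →L[ℂ] HilbTensor H H),
      star a ∈ sandwich (rightTensorL H H)
        (↑(c * g)⁻¹ : HilbTensor H H →L[ℂ] HilbTensor H H) := fun a ha => by
    rw [← hs]
    exact star_mem_sandwich ha
  have h2 : ∀ a ∈ sandwich (rightTensorL H H) (↑(c * g)⁻¹ : HilbTensor H H →L[ℂ] HilbTensor H H),
      star a ∈ sandwich (rightTensorL H H)
        (↑(c * g) : HilbTensor H H →L[ℂ] HilbTensor H H) := fun a ha => by
    rw [← hs']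
    exact star_mem_sandwich ha
  have h3 : sandwich (rightTensorL H H) (↑(c * g) : HilbTensor H H →L[ℂ] HilbTensor H H)
      ≤ sandwich (rightTensorL H H) ↑(c * g)⁻¹ := fun a ha => by
    have h4 := h1 a ha
    rw [← h.closedMul_star] at h4
    have h5 := star_mem_closedMul h1 h2 h4
    rwa [star_star, h.closedMul_star] at h5
  refine le_antisymm (fun a ha => ?_) h3
  simpa using h2 _ (h3 (h2 a ha))

/-- `Â(F)` is a non-degenerate C*-algebra. -/
theorem isNondegenerateCStarSubalgebra [Nontrivial H] (h : IsRegularPair c g) :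
    IsNondegenerateCStarSubalgebra
      (sliceSpace (↑(c * g) : HilbTensor H H →L[ℂ] HilbTensor H H)) := by
  have hs : star (↑(c * g) : HilbTensor H H →L[ℂ] HilbTensor H H) = ↑(c * g)⁻¹ :=
    congrArg Units.val h.star_mul
  rw [sliceSpace_eq_sandwich]
  refine ⟨isClosed_closedSpan _, fun a ha b hb => ?_, fun a ha => ?_, ?_⟩
  · have h1 := h.closedMul_star
    rw [h.sandwich_inv] at h1
    rw [← h1]
    exact mul_mem_closedMul ha hb
  · rw [← h.sandwich_inv, ← hs]
    exact star_mem_sandwich ha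
  · exact isNondegenerateSpace_sandwich_of_surjective
      fun σ => ⟨(↑(c * g)⁻¹ : HilbTensor H H →L[ℂ] HilbTensor H H) σ,
        congrArg (fun f => f σ) (c * g).mul_inv⟩

variable (H) in
theorem commute_leg₁₂_leg₃₄ (X Y : (HilbTensor H H →L[ℂ] HilbTensor H H)ˣ) :
    Commute (leg₁₂₃ H (leg₁₂ H X)) (leg₃₄ H Y) :=
  Units.ext (commute_tensorId_lastTwo (X : HilbTensor H H →L[ℂ] HilbTensor H H)
    (Y : HilbTensor H H →L[ℂ] HilbTensor H H))

theorem relations_right (h : IsRegularPair c g) :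
    IsBraidedPair (leg₁₂₃ H (leg₂₃ H c)) (leg₃₄ H c) (leg₁₂₃ H (leg₂₃ H g)) (leg₃₄ H g) := by
  have h1 : ∀ X, Units.map (lastThree H H H) (leg₁₂ H X) = leg₁₂₃ H (leg₂₃ H X) := fun X =>
    Units.ext (lastThree_tensorId H (X : HilbTensor H H →L[ℂ] HilbTensor H H))
  have h2 : ∀ X, Units.map (lastThree H H H) (leg₂₃ H X) = leg₃₄ H X := fun X =>
    Units.ext (lastThree_lastTwo H (X : HilbTensor H H →L[ℂ] HilbTensor H H))
  exact h.relations.map_eq (Units.map (lastThree H H H)) (h1 c) (h2 c) (h1 g) (h2 g)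

variable (H) in
/-- The closed span of the slices in the third leg of an operator on `(H ⊗ H) ⊗ H`. -/
def lastSlices (W : (HilbTensor (HilbTensor H H) H →L[ℂ] HilbTensor (HilbTensor H H) H)ˣ) :
    Submodule ℂ (HilbTensor H H →L[ℂ] HilbTensor H H) :=
  sandwich (rightTensorL (HilbTensor H H) H)
    (W : HilbTensor (HilbTensor H H) H →L[ℂ] HilbTensor (HilbTensor H H) H)

variable (H) in
/-- The closed span of the slices in the last two legs of an operator on `((H ⊗ H) ⊗ H) ⊗ H`. -/
def lastTwoSlices (W : (HilbTensor (HilbTensor (HilbTensor H H) H) H →L[ℂ]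
      HilbTensor (HilbTensor (HilbTensor H H) H) H)ˣ) :
    Submodule ℂ (HilbTensor H H →L[ℂ] HilbTensor H H) :=
  sandwich (rightTensorTwoL (HilbTensor H H) H)
    (W : HilbTensor (HilbTensor (HilbTensor H H) H) H →L[ℂ]
      HilbTensor (HilbTensor (HilbTensor H H) H) H)

/-- `closedMul_slices` for operators on `H ⊗ H`. -/
theorem closedMul_lastSlices {Y : (HilbTensor H H →L[ℂ] HilbTensor H H)ˣ}
    (hY : (sliceSpace (Y : HilbTensor H H →L[ℂ] HilbTensor H H) : Set (H →L[ℂ] H))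
      = {T : H →L[ℂ] H | IsCompactOperator T})
    (W₁ W₂ : (HilbTensor (HilbTensor H H) H →L[ℂ] HilbTensor (HilbTensor H H) H)ˣ) :
    closedMul (lastSlices H W₁) (lastSlices H W₂)
      = lastTwoSlices H (leg₁₂₃ H W₁ * leg₃₄ H Y * leg₁₂₃ H W₂) :=
  closedMul_slices hY _ _

theorem lastTwoSlices_mul (W : (HilbTensor (HilbTensor (HilbTensor H H) H) H →L[ℂ]
      HilbTensor (HilbTensor (HilbTensor H H) H) H)ˣ)
    (X : (HilbTensor H H →L[ℂ] HilbTensor H H)ˣ) :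
    lastTwoSlices H (W * leg₃₄ H X) = lastTwoSlices H W :=
  sandwich_mul_lastTwo _ X

theorem lastTwoSlices_mul_left (W : (HilbTensor (HilbTensor (HilbTensor H H) H) H →L[ℂ]
      HilbTensor (HilbTensor (HilbTensor H H) H) H)ˣ)
    (X : (HilbTensor H H →L[ℂ] HilbTensor H H)ˣ) :
    lastTwoSlices H (leg₃₄ H X * W) = lastTwoSlices H W :=
  sandwich_lastTwo_mul _ X

/-- The operator `c₂₃⁻¹ F₁₂ c₂₃ = c₁₂ F₂₃ c₁₂⁻¹`, whose slices in the third leg are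
`Â(F) ⊠ id`. -/
def leftUnit (c g : (HilbTensor H H →L[ℂ] HilbTensor H H)ˣ) :
    (HilbTensor (HilbTensor H H) H →L[ℂ] HilbTensor (HilbTensor H H) H)ˣ :=
  (leg₂₃ H c)⁻¹ * (leg₁₂ H c * leg₁₂ H g) * leg₂₃ H c

/-- The operator `F̂₂₃ = c₂₃⁻¹ g₂₃⁻¹`, whose slices in the third leg are `id ⊠ Â(F̂)`. -/
def rightUnit (c g : (HilbTensor H H →L[ℂ] HilbTensor H H)ˣ) :
    (HilbTensor (HilbTensor H H) H →L[ℂ] HilbTensor (HilbTensor H H) H)ˣ :=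
  (leg₂₃ H c)⁻¹ * (leg₂₃ H g)⁻¹

/-- `(Â(F) ⊠ id)(id ⊠ Â(F̂))` and `(id ⊠ Â(F̂))(Â(F) ⊠ id)` span the same space, by the
regularity of the braiding. -/
theorem closedMul_comm (h : IsRegularPair c g) :
    closedMul (lastSlices H (leftUnit c g)) (lastSlices H (rightUnit c g))
      = closedMul (lastSlices H (rightUnit c g)) (lastSlices H (leftUnit c g)) := by
  obtain ⟨Z, h1, h2⟩ := exists_word_comm h.relations_right (commute_leg₁₂_leg₃₄ H)
  calc closedMul (lastSlices H (leftUnit c g)) (lastSlices H (rightUnit c g))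
      = lastTwoSlices H (leg₁₂₃ H (leftUnit c g) * leg₃₄ H c * leg₁₂₃ H (rightUnit c g)) :=
        closedMul_lastSlices (Y := c) h.regular_braid _ _
    _ = lastTwoSlices H (Z * leg₃₄ H c) := congrArg (lastTwoSlices H) h1
    _ = lastTwoSlices H Z := lastTwoSlices_mul Z c
    _ = lastTwoSlices H (leg₃₄ H c⁻¹ * Z) := (lastTwoSlices_mul_left Z c⁻¹).symm
    _ = lastTwoSlices H (leg₁₂₃ H (rightUnit c g) * leg₃₄ H c⁻¹ * leg₁₂₃ H (leftUnit c g)) :=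
        (congrArg (lastTwoSlices H) h2).symm
    _ = closedMul (lastSlices H (rightUnit c g)) (lastSlices H (leftUnit c g)) :=
        (closedMul_lastSlices (Y := c⁻¹) h.dual.regular_braid _ _).symm

/-- `(Â(F) ⊠ id) F (id ⊠ Â(F̂))` spans the same space as `(id ⊠ Â(F̂))(Â(F) ⊠ id)`. The hypothesis
holds by the duality and `sandwich_inv`, see `lastSlices_rightUnit_inv`. -/
theorem lastSlices_left_mul (h : IsRegularPair c g)
    (hB : lastSlices H (rightUnit c g)⁻¹ = lastSlices H (rightUnit c g)) :
    closedMul (lastSlices H (leftUnit c g * leg₁₂ H (c * g))) (lastSlices H (rightUnit c g))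
      = closedMul (lastSlices H (rightUnit c g)) (lastSlices H (leftUnit c g)) := by
  obtain ⟨Z, h1, h2⟩ := exists_word_left_mul h.relations h.relations_right
    (commute_leg₁₂_leg₃₄ H)
  rw [← hB]
  calc closedMul (lastSlices H (leftUnit c g * leg₁₂ H (c * g))) (lastSlices H (rightUnit c g)⁻¹)
      = lastTwoSlices H (leg₁₂₃ H (leftUnit c g * leg₁₂ H (c * g)) * leg₃₄ H g⁻¹
          * leg₁₂₃ H (rightUnit c g)⁻¹) :=
        closedMul_lastSlices (Y := g⁻¹) h.dual.regular_unitary _ _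
    _ = lastTwoSlices H (leg₃₄ H g⁻¹ * Z * leg₃₄ H g⁻¹) := congrArg (lastTwoSlices H) h1
    _ = lastTwoSlices H (leg₃₄ H g⁻¹ * Z) := lastTwoSlices_mul _ g⁻¹
    _ = lastTwoSlices H Z := lastTwoSlices_mul_left Z g⁻¹
    _ = lastTwoSlices H (leg₁₂₃ H (rightUnit c g)⁻¹ * leg₃₄ H g * leg₁₂₃ H (leftUnit c g)) :=
        (congrArg (lastTwoSlices H) h2).symm
    _ = closedMul (lastSlices H (rightUnit c g)⁻¹) (lastSlices H (leftUnit c g)) :=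
        (closedMul_lastSlices (Y := g) h.regular_unitary _ _).symm

/-- `(id ⊠ Â(F̂))(Â(F) ⊠ id) F` spans the same space as `(Â(F) ⊠ id)(id ⊠ Â(F̂))`. -/
theorem lastSlices_right_mul (h : IsRegularPair c g) :
    closedMul (lastSlices H (rightUnit c g)) (lastSlices H (leftUnit c g * leg₁₂ H (c * g)))
      = closedMul (lastSlices H (leftUnit c g)) (lastSlices H (rightUnit c g)) := by
  obtain ⟨Z, h1, h2⟩ := exists_word_right_mul h.relations h.relations_right
    (commute_leg₁₂_leg₃₄ H)
  calc closedMul (lastSlices H (rightUnit c g)) (lastSlices H (leftUnit c g * leg₁₂ H (c * g)))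
      = lastTwoSlices H (leg₁₂₃ H (rightUnit c g) * leg₃₄ H g
          * leg₁₂₃ H (leftUnit c g * leg₁₂ H (c * g))) :=
        closedMul_lastSlices (Y := g) h.regular_unitary _ _
    _ = lastTwoSlices H (leg₃₄ H g * Z) := congrArg (lastTwoSlices H) h1
    _ = lastTwoSlices H Z := lastTwoSlices_mul_left Z g
    _ = lastTwoSlices H (Z * leg₃₄ H g⁻¹) := (lastTwoSlices_mul Z g⁻¹).symm
    _ = lastTwoSlices H (leg₁₂₃ H (leftUnit c g) * leg₃₄ H g⁻¹ * leg₁₂₃ H (rightUnit c g)) :=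
        (congrArg (lastTwoSlices H) h2).symm
    _ = closedMul (lastSlices H (leftUnit c g)) (lastSlices H (rightUnit c g)) :=
        (closedMul_lastSlices (Y := g⁻¹) h.dual.regular_unitary _ _).symm

/-- `Â(F) ⊠ id` in terms of slices in the third leg. -/
theorem lastSlices_conj (X Z Y : (HilbTensor H H →L[ℂ] HilbTensor H H)ˣ) :
    lastSlices H (leg₁₂ H X * leg₂₃ H Y * leg₁₂ H Z)
      = closedSpan ((compBoth (X : HilbTensor H H →L[ℂ] HilbTensor H H)
          (Z : HilbTensor H H →L[ℂ] HilbTensor H H)).comp (idTensorL H H H) ''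
        {T | ∃ η ξ, T = (ContinuousLinearMap.adjoint (rightTensorL H H η)).comp
          ((Y : HilbTensor H H →L[ℂ] HilbTensor H H).comp (rightTensorL H H ξ))}) :=
  sandwich_tensorId_mul_lastTwo_mul_tensorId _ _ _

/-- `id ⊠ Â(F̂)` in terms of slices in the third leg. -/
theorem lastSlices_leg₂₃ (Y : (HilbTensor H H →L[ℂ] HilbTensor H H)ˣ) :
    lastSlices H (leg₂₃ H Y) = closedSpan (idTensorL H H H ''
        {T | ∃ η ξ, T = (ContinuousLinearMap.adjoint (rightTensorL H H η)).comp
          ((Y : HilbTensor H H →L[ℂ] HilbTensor H H).comp (rightTensorL H H ξ))}) := by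
  have h := lastSlices_conj 1 1 Y
  rw [map_one, one_mul, mul_one] at h
  exact h

theorem leftUnit_eq (h : IsRegularPair c g) :
    leftUnit c g = leg₁₂ H c * leg₂₃ H (c * g) * leg₁₂ H c⁻¹ := by
  rw [map_mul, map_inv]
  exact h.relations.conj_left.symm

theorem rightUnit_eq : rightUnit c g = leg₂₃ H (c⁻¹ * g⁻¹) := by
  rw [map_mul, map_inv, map_inv]
  rfl

end IsRegularPair

end Hilbert

/-! ### Closed images of operator spaces -/

section HilbertAlgebra

variable {V H : Type*} [NormedAddCommGroup H] [InnerProductSpace ℂ H] [CompleteSpace H]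
  [NormedAddCommGroup V] [InnerProductSpace ℂ V] [CompleteSpace V]

omit [CompleteSpace V] in
theorem closedMul_mono {P P' Q Q' : Submodule ℂ (V →L[ℂ] V)} (hP : P ≤ P') (hQ : Q ≤ Q') :
    closedMul P Q ≤ closedMul P' Q' :=
  Submodule.topologicalClosure_mono
    (Submodule.mul_le.2 fun _ ha _ hb => Submodule.mul_mem_mul (hP ha) (hQ hb))

theorem mul_right_mem_closedMul {P Q Q' : Submodule ℂ (V →L[ℂ] V)} {X T : V →L[ℂ] V}
    (h : ∀ b ∈ Q, b * X ∈ Q') (hT : T ∈ closedMul P Q) : T * X ∈ closedMul P Q' := by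
  rw [← compBoth_one_left]
  refine map_mem_of_mem_closedMul (isClosed_closedMul P Q') (compBoth 1 X) (fun a ha b hb => ?_) hT
  rw [compBoth_one_left, mul_assoc]
  exact mul_mem_closedMul ha (h b hb)

omit [CompleteSpace H] in
theorem mul_right_mem_sandwich {W : HilbTensor V H →L[ℂ] HilbTensor V H} {X T : V →L[ℂ] V}
    (hT : T ∈ sandwich (rightTensorL V H) W) :
    T * X ∈ sandwich (rightTensorL V H) (W * tensorId H X) := by
  have hM : IsClosed ((sandwich (rightTensorL V H) (W * tensorId H X) : Submodule ℂ _) :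
      Set (V →L[ℂ] V)) := isClosed_closedSpan _
  rw [← compBoth_one_left]
  refine map_mem_of_mem_closedSpan hM (compBoth 1 X) ?_ hT
  rintro _ ⟨η, ξ, rfl⟩
  refine subset_closedSpan _ ⟨η, ξ, ?_⟩
  have h := tensorId_comp_rightTensorL X ξ
  rw [compBoth_one_left]
  calc _ = (ContinuousLinearMap.adjoint (rightTensorL V H η)).comp
        (W.comp ((rightTensorL V H ξ).comp X)) := rfl
    _ = _ := by
      rw [← h]
      rfl

/-- A selfadjoint space of operators is invariant under left multiplication by an operator if it
is invariant under right multiplication by its adjoint. -/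
theorem mul_left_mem_of_star {P : Submodule ℂ (V →L[ℂ] V)} (hP : ∀ x ∈ P, star x ∈ P)
    {m m' : V →L[ℂ] V} (hm : star m' = m) (h : ∀ x ∈ P, x * m' ∈ P) : ∀ x ∈ P, m * x ∈ P := by
  intro x hx
  have h1 := hP _ (h _ (hP x hx))
  rwa [star_mul, hm, star_star] at h1

omit [CompleteSpace H] in
/-- The closed image of an algebra of operators under a homomorphism is an algebra. -/
theorem closedMul_map_le {S : Set (H →L[ℂ] H)} (Φ : (H →L[ℂ] H) →L[ℂ] (V →L[ℂ] V))
    (hΦ : ∀ a b, Φ (a * b) = Φ a * Φ b)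
    (hS : ∀ a ∈ closedSpan S, ∀ b ∈ closedSpan S, a * b ∈ closedSpan S) :
    closedMul (closedSpan (Φ '' S)) (closedSpan (Φ '' S)) ≤ closedSpan (Φ '' S) := by
  rw [← closedSpan_map_mul_map]
  refine closedSpan_le (isClosed_closedSpan _) ?_
  rintro _ ⟨a, ha, b, hb, rfl⟩
  rw [← hΦ]
  exact map_mem_of_mem_closedSpan (isClosed_closedSpan (Φ '' S)) Φ
    (fun T hT => subset_closedSpan _ ⟨T, hT, rfl⟩) (hS a ha b hb)

/-- The closed image of a selfadjoint space of operators under a `*`-preserving map is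
selfadjoint. -/
theorem star_mem_closedSpan_map {S : Set (H →L[ℂ] H)} (Φ : (H →L[ℂ] H) →L[ℂ] (V →L[ℂ] V))
    (hΦ : ∀ a, star (Φ a) = Φ (star a)) (hS : ∀ a ∈ closedSpan S, star a ∈ closedSpan S)
    {T : V →L[ℂ] V} (hT : T ∈ closedSpan (Φ '' S)) : star T ∈ closedSpan (Φ '' S) := by
  refine map_mem_of_mem_closedSpan (isClosed_closedSpan (Φ '' S))
    (starL ℂ : (V →L[ℂ] V) ≃L⋆[ℂ] (V →L[ℂ] V)).toContinuousLinearMap ?_ hT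
  rintro _ ⟨s, hs, rfl⟩
  have h := map_mem_of_mem_closedSpan (isClosed_closedSpan (Φ '' S)) Φ
    (fun T hT => subset_closedSpan _ ⟨T, hT, rfl⟩) (hS s (subset_closedSpan _ hs))
  rw [← hΦ] at h
  exact h

omit [CompleteSpace H] in
theorem closedSpan_map_closedSpan {S : Set (H →L[ℂ] H)} (Φ : (H →L[ℂ] H) →L[ℂ] (V →L[ℂ] V)) :
    closedSpan (Φ '' S) = closedSpan (Φ '' (closedSpan S : Set (H →L[ℂ] H))) := by
  refine le_antisymm (closedSpan_le (isClosed_closedSpan _) ?_)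
    (closedSpan_le (isClosed_closedSpan _) ?_)
  · rintro _ ⟨s, hs, rfl⟩
    exact subset_closedSpan _ ⟨s, subset_closedSpan _ hs, rfl⟩
  · rintro _ ⟨s, hs, rfl⟩
    exact map_mem_of_mem_closedSpan (isClosed_closedSpan (Φ '' S)) Φ
      (fun T hT => subset_closedSpan _ ⟨T, hT, rfl⟩) hs

/-! ### The braided tensor product -/

namespace IsRegularPair

variable {c g : (HilbTensor H H →L[ℂ] HilbTensor H H)ˣ}

variable (c) in
/-- `a ↦ a ⊠ id = c (id ⊗ a) c⁻¹` as a bounded linear map. -/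
def leftL : (H →L[ℂ] H) →L[ℂ] (HilbTensor H H →L[ℂ] HilbTensor H H) :=
  (compBoth (c : HilbTensor H H →L[ℂ] HilbTensor H H)
    (↑c⁻¹ : HilbTensor H H →L[ℂ] HilbTensor H H)).comp (idTensorL H H H)

omit [CompleteSpace H] in
theorem leftL_apply (a : H →L[ℂ] H) :
    leftL c a = (c : HilbTensor H H →L[ℂ] HilbTensor H H).comp ((idTensor H a).comp
      (↑c⁻¹ : HilbTensor H H →L[ℂ] HilbTensor H H)) := rfl

omit [CompleteSpace H] in
theorem leftL_mul (a b : H →L[ℂ] H) : leftL c (a * b) = leftL c a * leftL c b := by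
  have h : (↑c⁻¹ : HilbTensor H H →L[ℂ] HilbTensor H H) * ↑c = 1 := c.inv_mul
  rw [leftL_apply, ContinuousLinearMap.mul_def, idTensor_comp]
  calc _ = (c : HilbTensor H H →L[ℂ] HilbTensor H H) * idTensor H a * 1 * idTensor H b * ↑c⁻¹ := rfl
    _ = _ := by
      rw [← h]
      rfl

theorem star_leftL (hc : star c = c⁻¹) (a : H →L[ℂ] H) : star (leftL c a) = leftL c (star a) := by
  have h1 : ContinuousLinearMap.adjoint (c : HilbTensor H H →L[ℂ] HilbTensor H H) = ↑c⁻¹ :=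
    congrArg Units.val hc
  have h2 : ContinuousLinearMap.adjoint (↑c⁻¹ : HilbTensor H H →L[ℂ] HilbTensor H H) = ↑c := by
    rw [← h1, ContinuousLinearMap.adjoint_adjoint]
  rw [leftL_apply, leftL_apply, ContinuousLinearMap.star_eq_adjoint,
    ContinuousLinearMap.adjoint_comp, ContinuousLinearMap.adjoint_comp, adjoint_idTensor, h1, h2]
  rfl

/-- The generators of the slices of an operator. -/
def sliceSet (Y : (HilbTensor H H →L[ℂ] HilbTensor H H)ˣ) : Set (H →L[ℂ] H) :=
  {T | ∃ η ξ, T = (ContinuousLinearMap.adjoint (rightTensorL H H η)).comp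
    ((Y : HilbTensor H H →L[ℂ] HilbTensor H H).comp (rightTensorL H H ξ))}

theorem sliceSpace_eq (Y : (HilbTensor H H →L[ℂ] HilbTensor H H)ˣ) :
    sliceSpace (Y : HilbTensor H H →L[ℂ] HilbTensor H H) = closedSpan (sliceSet Y) :=
  sliceSpace_eq_sandwich _

theorem lastSlices_leftUnit (h : IsRegularPair c g) :
    lastSlices H (leftUnit c g) = closedSpan (leftL c '' sliceSet (c * g)) := by
  rw [h.leftUnit_eq]
  exact lastSlices_conj c c⁻¹ (c * g)

theorem lastSlices_rightUnit :
    lastSlices H (rightUnit c g) = closedSpan (idTensorL H H H '' sliceSet (c⁻¹ * g⁻¹)) := by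
  rw [rightUnit_eq]
  exact lastSlices_leg₂₃ (c⁻¹ * g⁻¹)

theorem lastSlices_rightUnit_inv [Nontrivial H] (h : IsRegularPair c g) :
    lastSlices H (rightUnit c g)⁻¹ = lastSlices H (rightUnit c g) := by
  rw [lastSlices_rightUnit, rightUnit_eq, ← map_inv, lastSlices_leg₂₃, closedSpan_map_closedSpan,
    closedSpan_map_closedSpan (S := sliceSet _)]
  exact congrArg (fun P : Submodule ℂ (H →L[ℂ] H) =>
    closedSpan (idTensorL H H H '' (P : Set (H →L[ℂ] H)))) h.dual.sandwich_inv

omit [CompleteSpace H] in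
theorem mul_mem_lastSlices {W : (HilbTensor (HilbTensor H H) H →L[ℂ] HilbTensor (HilbTensor H H) H)ˣ}
    (X : (HilbTensor H H →L[ℂ] HilbTensor H H)ˣ) {T : HilbTensor H H →L[ℂ] HilbTensor H H}
    (hT : T ∈ lastSlices H W) :
    T * (X : HilbTensor H H →L[ℂ] HilbTensor H H) ∈ lastSlices H (W * leg₁₂ H X) :=
  mul_right_mem_sandwich hT

variable (c g) in
/-- The braided tensor product `Â(F) ⊠ Â(F̂)`. -/
def braidedAlgebra : Submodule ℂ (HilbTensor H H →L[ℂ] HilbTensor H H) :=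
  closedMul (lastSlices H (leftUnit c g)) (lastSlices H (rightUnit c g))

theorem braidedAlgebra_eq (h : IsRegularPair c g) :
    closedSpan {T | ∃ a ∈ sliceSpace (↑(c * g) : HilbTensor H H →L[ℂ] HilbTensor H H),
        ∃ b ∈ sliceSpace (↑(c⁻¹ * g⁻¹) : HilbTensor H H →L[ℂ] HilbTensor H H),
        T = leftL c a * idTensor H b} = braidedAlgebra c g := by
  rw [braidedAlgebra, h.lastSlices_leftUnit, lastSlices_rightUnit, sliceSpace_eq, sliceSpace_eq]
  exact closedSpan_map_mul_map (leftL c) (idTensorL H H H) _ _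

/-- `(Â(F) ⊠ id) F (id ⊠ Â(F̂))` spans the braided tensor product. -/
theorem closedSpan_mul_unitary_mul [Nontrivial H] (h : IsRegularPair c g) :
    closedSpan {T | ∃ a ∈ sliceSpace (↑(c * g) : HilbTensor H H →L[ℂ] HilbTensor H H),
        ∃ b ∈ sliceSpace (↑(c⁻¹ * g⁻¹) : HilbTensor H H →L[ℂ] HilbTensor H H),
        T = leftL c a * (↑(c * g) : HilbTensor H H →L[ℂ] HilbTensor H H) * idTensor H b}
      = braidedAlgebra c g := by
  have h1 : lastSlices H (leftUnit c g * leg₁₂ H (c * g))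
      = closedSpan ((compBoth 1 (↑(c * g) : HilbTensor H H →L[ℂ] HilbTensor H H)).comp (leftL c)
        '' sliceSet (c * g)) := by
    rw [h.leftUnit_eq, mul_assoc, ← map_mul]
    exact lastSlices_conj c (c⁻¹ * (c * g)) (c * g)
  rw [braidedAlgebra, h.closedMul_comm, ← h.lastSlices_left_mul h.lastSlices_rightUnit_inv, h1,
    lastSlices_rightUnit, sliceSpace_eq, sliceSpace_eq, ← closedSpan_map_mul_map]
  rfl

theorem mul_mem_lastSlices_leftUnit [Nontrivial H] (h : IsRegularPair c g) :
    closedMul (lastSlices H (leftUnit c g)) (lastSlices H (leftUnit c g))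
      ≤ lastSlices H (leftUnit c g) := by
  rw [h.lastSlices_leftUnit]
  refine closedMul_map_le (leftL c) leftL_mul ?_
  rw [← sliceSpace_eq]
  exact h.isNondegenerateCStarSubalgebra.mul_mem

theorem mul_mem_lastSlices_rightUnit [Nontrivial H] (h : IsRegularPair c g) :
    closedMul (lastSlices H (rightUnit c g)) (lastSlices H (rightUnit c g))
      ≤ lastSlices H (rightUnit c g) := by
  rw [lastSlices_rightUnit]
  refine closedMul_map_le (idTensorL H H H) idTensor_comp ?_
  rw [← sliceSpace_eq]
  exact h.dual.isNondegenerateCStarSubalgebra.mul_mem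

theorem star_mem_lastSlices_leftUnit [Nontrivial H] (h : IsRegularPair c g) :
    ∀ T ∈ lastSlices H (leftUnit c g), star T ∈ lastSlices H (leftUnit c g) := by
  intro T hT
  rw [h.lastSlices_leftUnit] at hT ⊢
  refine star_mem_closedSpan_map (leftL c) (star_leftL h.star_braid) ?_ hT
  rw [← sliceSpace_eq]
  exact h.isNondegenerateCStarSubalgebra.star_mem

theorem star_mem_lastSlices_rightUnit [Nontrivial H] (h : IsRegularPair c g) :
    ∀ T ∈ lastSlices H (rightUnit c g), star T ∈ lastSlices H (rightUnit c g) := by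
  intro T hT
  rw [lastSlices_rightUnit] at hT ⊢
  refine star_mem_closedSpan_map (idTensorL H H H) adjoint_idTensor ?_ hT
  rw [← sliceSpace_eq]
  exact h.dual.isNondegenerateCStarSubalgebra.star_mem

variable (H) in
omit [CompleteSpace H] in
theorem isNondegenerateSpace_lastSlices [Nontrivial H]
    (W : (HilbTensor (HilbTensor H H) H →L[ℂ] HilbTensor (HilbTensor H H) H)ˣ) :
    IsNondegenerateSpace (lastSlices H W) :=
  isNondegenerateSpace_sandwich_of_surjective fun σ =>
    ⟨(↑W⁻¹ : HilbTensor (HilbTensor H H) H →L[ℂ] HilbTensor (HilbTensor H H) H) σ,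
      congrArg (fun f => f σ) W.mul_inv⟩

theorem star_mem_braidedAlgebra [Nontrivial H] (h : IsRegularPair c g) :
    ∀ T ∈ braidedAlgebra c g, star T ∈ braidedAlgebra c g := by
  intro T hT
  have h1 := star_mem_closedMul h.star_mem_lastSlices_leftUnit h.star_mem_lastSlices_rightUnit hT
  rwa [← h.closedMul_comm] at h1

theorem isNondegenerateCStarSubalgebra_braidedAlgebra [Nontrivial H] (h : IsRegularPair c g) :
    IsNondegenerateCStarSubalgebra (braidedAlgebra c g) where
  isClosed := isClosed_closedMul _ _
  mul_mem a ha b hb := by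
    have h1 : closedMul (braidedAlgebra c g) (braidedAlgebra c g) ≤ braidedAlgebra c g := by
      unfold braidedAlgebra
      rw [closedMul_assoc, ← closedMul_assoc (lastSlices H (rightUnit c g)), ← h.closedMul_comm,
        closedMul_assoc, ← closedMul_assoc]
      exact closedMul_mono h.mul_mem_lastSlices_leftUnit h.mul_mem_lastSlices_rightUnit
    exact h1 (mul_mem_closedMul ha hb)
  star_mem := h.star_mem_braidedAlgebra
  nondegenerate := (isNondegenerateSpace_lastSlices H _).closedMul
    (isNondegenerateSpace_lastSlices H _)

theorem isMultiplier_braidedAlgebra [Nontrivial H] (h : IsRegularPair c g) :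
    IsMultiplier (braidedAlgebra c g) (↑(c * g) : HilbTensor H H →L[ℂ] HilbTensor H H) := by
  have hs : star (↑(c * g)⁻¹ : HilbTensor H H →L[ℂ] HilbTensor H H) = ↑(c * g) :=
    congrArg Units.val (show star (c * g)⁻¹ = c * g by rw [star_inv, h.star_mul, inv_inv])
  have h1 : ∀ x ∈ braidedAlgebra c g,
      x * (↑(c * g) : HilbTensor H H →L[ℂ] HilbTensor H H) ∈ braidedAlgebra c g := fun x hx => by
    rw [braidedAlgebra, h.closedMul_comm] at hx
    rw [braidedAlgebra, ← h.lastSlices_right_mul]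
    exact mul_right_mem_closedMul (fun b hb => mul_mem_lastSlices (c * g) hb) hx
  have h2 : ∀ x ∈ braidedAlgebra c g,
      x * (↑(c * g)⁻¹ : HilbTensor H H →L[ℂ] HilbTensor H H) ∈ braidedAlgebra c g := fun x hx => by
    rw [braidedAlgebra, ← h.lastSlices_right_mul] at hx
    rw [braidedAlgebra, h.closedMul_comm]
    refine mul_right_mem_closedMul (fun b hb => ?_) hx
    have := mul_mem_lastSlices (c * g)⁻¹ hb
    rwa [map_inv, mul_inv_cancel_right] at this
  exact fun x hx => ⟨mul_left_mem_of_star h.star_mem_braidedAlgebra hs h2 x hx, h1 x hx⟩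

end IsRegularPair

end HilbertAlgebra

/-! ### Multiplicative unitaries in a braided category -/

namespace IsBraidedPair

/-- The naturality of `F = f` with respect to the braiding and the braided pentagon equation
`F₂₃ F₁₂ = F₁₂ c₁₂⁻¹ F₂₃ c₁₂ F₂₃` yield the relations for `c⁻¹F`. -/
theorem of_pentagon {Γ : Type*} [Group Γ] {c c' f f' : Γ} (hyb : c * c' * c = c' * c * c')
    (hl : c * c' * f = f' * c * c') (hr : c' * c * f' = f * c' * c)
    (hp : f' * f = f * c⁻¹ * f' * c * f') : IsBraidedPair c c' (c⁻¹ * f) (c'⁻¹ * f') where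
  yang_baxter := hyb
  naturality_left := by
    calc c * c' * (c⁻¹ * f) = c'⁻¹ * (c' * c * c') * c⁻¹ * f := by group
      _ = c'⁻¹ * (c * c' * f) := by rw [← hyb]; group
      _ = c'⁻¹ * f' * c * c' := by rw [hl]; group
  naturality_right := by
    calc c' * c * (c'⁻¹ * f') = c⁻¹ * (c * c' * c) * c'⁻¹ * f' := by group
      _ = c⁻¹ * (c' * c * f') := by rw [hyb]; group
      _ = c⁻¹ * f * c' * c := by rw [hr]; group
  pentagon := by
    have h1 : c⁻¹ * f' * c = c' * f * c'⁻¹ := by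
      calc c⁻¹ * f' * c = c⁻¹ * (f' * c * c') * c'⁻¹ := by group
        _ = c' * f * c'⁻¹ := by rw [← hl]; group
    refine mul_left_cancel (a := c * c' * c) ?_
    calc c * c' * c * (c'⁻¹ * f' * (c⁻¹ * f) * (c'⁻¹ * f'))
        = (c * c' * c) * c'⁻¹ * f' * c⁻¹ * f * c'⁻¹ * f' := by group
      _ = (c' * c * f') * c⁻¹ * f * c'⁻¹ * f' := by rw [hyb]; group
      _ = f * (c' * f * c'⁻¹) * f' := by rw [hr]; group
      _ = f' * f := by rw [← h1, hp]; group
      _ = (f' * c * c') * c'⁻¹ * c⁻¹ * f := by group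
      _ = (c * c' * c) * (c⁻¹ * f) * c'⁻¹ * c⁻¹ * f := by rw [← hl]; group
      _ = c * c' * c * (c⁻¹ * f * c'⁻¹ * (c⁻¹ * f)) := by group

end IsBraidedPair

section Concrete

variable {C : Type u} [Category.{v} C] [MonoidalCategory C]

variable (L : C) in
/-- The automorphisms of `L ⊗ L`, acting on the legs 12 of `(L ⊗ L) ⊗ L`. -/
def autLeg₁₂ : Aut (L ⊗ L) →* Aut ((L ⊗ L) ⊗ L) where
  toFun e := whiskerRightIso e L
  map_one' := Iso.ext (id_whiskerRight _ _)
  map_mul' _ _ := Iso.ext (comp_whiskerRight _ _ _)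

variable (L : C) in
/-- The automorphisms of `L ⊗ L`, acting on the legs 23 of `(L ⊗ L) ⊗ L`. -/
def autLeg₂₃ : Aut (L ⊗ L) →* Aut ((L ⊗ L) ⊗ L) where
  toFun e := α_ L L L ≪≫ whiskerLeftIso L e ≪≫ (α_ L L L).symm
  map_one' := Iso.ext (by
    change (α_ L L L).hom ≫ L ◁ 𝟙 _ ≫ (α_ L L L).inv = 𝟙 _
    simp)
  map_mul' e f := Iso.ext (by
    change (α_ L L L).hom ≫ L ◁ (f.hom ≫ e.hom) ≫ (α_ L L L).inv
      = ((α_ L L L).hom ≫ L ◁ f.hom ≫ (α_ L L L).inv) ≫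
        (α_ L L L).hom ≫ L ◁ e.hom ≫ (α_ L L L).inv
    simp)

section Braided

variable [BraidedCategory C]

variable (L : C) in
/-- The braiding as an automorphism of `L ⊗ L`. -/
def autBraid : Aut (L ⊗ L) := β_ L L

theorem autBraid_yang_baxter (L : C) :
    autLeg₁₂ L (autBraid L) * autLeg₂₃ L (autBraid L) * autLeg₁₂ L (autBraid L)
      = autLeg₂₃ L (autBraid L) * autLeg₁₂ L (autBraid L) * autLeg₂₃ L (autBraid L) := by
  refine Iso.ext ?_
  change (β_ L L).hom ▷ L ≫ ((α_ L L L).hom ≫ L ◁ (β_ L L).hom ≫ (α_ L L L).inv) ≫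
      (β_ L L).hom ▷ L
    = ((α_ L L L).hom ≫ L ◁ (β_ L L).hom ≫ (α_ L L L).inv) ≫ (β_ L L).hom ▷ L ≫
      ((α_ L L L).hom ≫ L ◁ (β_ L L).hom ≫ (α_ L L L).inv)
  have h := BraidedCategory.yang_baxter L L L
  rw [← cancel_epi (α_ L L L).inv, ← cancel_mono (α_ L L L).hom]
  simpa using h

theorem autBraid_naturality_left {L : C} (e : Aut (L ⊗ L)) :
    autLeg₁₂ L (autBraid L) * autLeg₂₃ L (autBraid L) * autLeg₁₂ L e
      = autLeg₂₃ L e * autLeg₁₂ L (autBraid L) * autLeg₂₃ L (autBraid L) := by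
  refine Iso.ext ?_
  change e.hom ▷ L ≫ ((α_ L L L).hom ≫ L ◁ (β_ L L).hom ≫ (α_ L L L).inv) ≫ (β_ L L).hom ▷ L
    = ((α_ L L L).hom ≫ L ◁ (β_ L L).hom ≫ (α_ L L L).inv) ≫ (β_ L L).hom ▷ L ≫
      ((α_ L L L).hom ≫ L ◁ e.hom ≫ (α_ L L L).inv)
  have h := BraidedCategory.braiding_naturality_left e.hom L
  rw [BraidedCategory.braiding_tensor_left_hom] at h
  rw [← cancel_mono (α_ L L L).hom]
  simpa using h

theorem autBraid_naturality_right {L : C} (e : Aut (L ⊗ L)) :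
    autLeg₂₃ L (autBraid L) * autLeg₁₂ L (autBraid L) * autLeg₂₃ L e
      = autLeg₁₂ L e * autLeg₂₃ L (autBraid L) * autLeg₁₂ L (autBraid L) := by
  refine Iso.ext ?_
  change ((α_ L L L).hom ≫ L ◁ e.hom ≫ (α_ L L L).inv) ≫ (β_ L L).hom ▷ L ≫
      ((α_ L L L).hom ≫ L ◁ (β_ L L).hom ≫ (α_ L L L).inv)
    = (β_ L L).hom ▷ L ≫ ((α_ L L L).hom ≫ L ◁ (β_ L L).hom ≫ (α_ L L L).inv) ≫ e.hom ▷ L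
  have h := BraidedCategory.braiding_naturality_right L e.hom
  rw [BraidedCategory.braiding_tensor_right_hom] at h
  rw [← cancel_epi (α_ L L L).inv]
  simpa using h

end Braided

variable [CStarCategory C]

/-- A unitary endomorphism as an automorphism. -/
def IsUnitaryHom.aut {X : C} {f : X ⟶ X} (hf : IsUnitaryHom f) : Aut X := ⟨f, dag f, hf.1, hf.2⟩

theorem IsMultiplicativeUnitary.isBraidedPair [BraidedCategory C] {L : C} {F : L ⊗ L ⟶ L ⊗ L}
    (hF : IsMultiplicativeUnitary F) :
    IsBraidedPair (autLeg₁₂ L (autBraid L)) (autLeg₂₃ L (autBraid L))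
      (autLeg₁₂ L ((autBraid L)⁻¹ * hF.1.aut)) (autLeg₂₃ L ((autBraid L)⁻¹ * hF.1.aut)) := by
  rw [map_mul, map_mul, map_inv, map_inv]
  refine IsBraidedPair.of_pentagon (autBraid_yang_baxter L) (autBraid_naturality_left _)
    (autBraid_naturality_right _) (Iso.ext ?_)
  exact hF.2

/-! ### Transport along the fibre functor -/

namespace FibreFunctor

variable [WStarCategory C] (Φ : FibreFunctor.{u, v, w} C)

theorem operator_comp {X Y Z : C} (f : X ⟶ Y) (g : Y ⟶ Z) :
    Φ.operator (f ≫ g) = (Φ.operator g).comp (Φ.operator f) :=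
  congrArg HilbSp.toCLM (Φ.functor.map_comp f g)

theorem operator_id (X : C) : Φ.operator (𝟙 X) = ContinuousLinearMap.id ℂ _ :=
  congrArg HilbSp.toCLM (Φ.functor.map_id X)

/-- The unitary `For(X) ⊗ For(Y) → For(X ⊗ Y)` as a bounded operator. -/
def tensorMap (X Y : C) : HilbTensor (Φ.space X) (Φ.space Y) →L[ℂ] Φ.space (X ⊗ Y) :=
  (Φ.tensorIso X Y).toContinuousLinearEquiv.toContinuousLinearMap

/-- The inverse of `tensorMap`. -/
def tensorMapInv (X Y : C) : Φ.space (X ⊗ Y) →L[ℂ] HilbTensor (Φ.space X) (Φ.space Y) :=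
  (Φ.tensorIso X Y).symm.toContinuousLinearEquiv.toContinuousLinearMap

theorem tensorMap_comp_inv (X Y : C) :
    (Φ.tensorMap X Y).comp (Φ.tensorMapInv X Y) = ContinuousLinearMap.id ℂ _ :=
  ContinuousLinearMap.ext fun t => (Φ.tensorIso X Y).apply_symm_apply t

theorem tensorMapInv_comp (X Y : C) :
    (Φ.tensorMapInv X Y).comp (Φ.tensorMap X Y) = ContinuousLinearMap.id ℂ _ :=
  ContinuousLinearMap.ext fun t => (Φ.tensorIso X Y).symm_apply_apply t

theorem tensorMapInv_tensorMap (X Y : C) (t : HilbTensor (Φ.space X) (Φ.space Y)) :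
    Φ.tensorMapInv X Y (Φ.tensorMap X Y t) = t := (Φ.tensorIso X Y).symm_apply_apply t

/-- The representation of the automorphisms of an object by invertible operators. -/
def unitsOperator (X : C) : Aut X →* (Φ.space X →L[ℂ] Φ.space X)ˣ where
  toFun e := ⟨Φ.operator e.hom, Φ.operator e.inv,
    by rw [ContinuousLinearMap.mul_def, ← operator_comp, e.inv_hom_id, operator_id]; rfl,
    by rw [ContinuousLinearMap.mul_def, ← operator_comp, e.hom_inv_id, operator_id]; rfl⟩
  map_one' := Units.ext (Φ.operator_id X)
  map_mul' e f := Units.ext (Φ.operator_comp f.hom e.hom)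

/-- The representation of the automorphisms of `X ⊗ Y` on the Hilbert space tensor product. -/
def unitsTensorOperator (X Y : C) : Aut (X ⊗ Y) →*
    (HilbTensor (Φ.space X) (Φ.space Y) →L[ℂ] HilbTensor (Φ.space X) (Φ.space Y))ˣ :=
  (Units.map (conjHom (Φ.tensorMap X Y) (Φ.tensorMapInv X Y) (Φ.tensorMap_comp_inv X Y)
    (Φ.tensorMapInv_comp X Y))).comp (Φ.unitsOperator (X ⊗ Y))

theorem coe_unitsTensorOperator {X Y : C} (e : Aut (X ⊗ Y)) :
    (Φ.unitsTensorOperator X Y e : HilbTensor (Φ.space X) (Φ.space Y) →L[ℂ] _)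
      = Φ.tensorOperator e.hom := rfl

theorem tensorOperator_dag {X Y : C} (f : X ⊗ Y ⟶ X ⊗ Y) :
    Φ.tensorOperator (dag f) = star (Φ.tensorOperator f) := by
  rw [ContinuousLinearMap.star_eq_adjoint, ContinuousLinearMap.eq_adjoint_iff]
  intro s t
  change ⟪(Φ.tensorIso X Y).symm (HilbSp.toCLM (Φ.functor.map (dag f)) (Φ.tensorIso X Y s)), t⟫_ℂ
    = ⟪s, (Φ.tensorIso X Y).symm (Φ.operator f (Φ.tensorIso X Y t))⟫_ℂ
  rw [Φ.map_dag, LinearIsometryEquiv.inner_map_eq_flip, LinearIsometryEquiv.symm_symm,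
    ContinuousLinearMap.adjoint_inner_left, LinearIsometryEquiv.inner_map_eq_flip]
  rfl

theorem star_unitsTensorOperator {X Y : C} {e : Aut (X ⊗ Y)} (he : IsUnitaryHom e.hom) :
    star (Φ.unitsTensorOperator X Y e) = (Φ.unitsTensorOperator X Y e)⁻¹ := by
  have h : e.inv = dag e.hom := by
    calc e.inv = e.inv ≫ e.hom ≫ dag e.hom := by rw [he.1, Category.comp_id]
      _ = dag e.hom := Iso.inv_hom_id_assoc (e : X ⊗ Y ≅ X ⊗ Y) (dag e.hom)
  rw [← map_inv]
  refine Units.ext ?_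
  change star (Φ.tensorOperator e.hom) = Φ.tensorOperator e.inv
  rw [h, tensorOperator_dag]

theorem tensorMap_natural {X X' Y Y' : C} (f : X ⟶ X') (g : Y ⟶ Y') :
    (Φ.operator (f ⊗ₘ g)).comp (Φ.tensorMap X Y)
      = (Φ.tensorMap X' Y').comp ((idTensor _ (Φ.operator g)).comp (tensorId _ (Φ.operator f))) :=
  HilbTensor.ext_clm fun x y => by
    simp only [ContinuousLinearMap.comp_apply, tensorId_pureTensor, idTensor_pureTensor]
    exact Φ.tensorIso_natural f g x y

theorem tensorOperator_whiskerRight {X : C} (f : X ⟶ X) (Y : C) :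
    Φ.tensorOperator (f ▷ Y) = tensorId (Φ.space Y) (Φ.operator f) := by
  have h := Φ.tensorMap_natural f (𝟙 Y)
  rw [tensorHom_id, operator_id, idTensor_id] at h
  change (Φ.tensorMapInv X Y).comp ((Φ.operator (f ▷ Y)).comp (Φ.tensorMap X Y)) = _
  rw [h]
  ext t
  exact Φ.tensorMapInv_tensorMap X Y _

variable (L : C)

/-- The unitary `(For(L) ⊗ For(L)) ⊗ For(L) → For(L ⊗ L) ⊗ For(L)`. -/
def tripleConj := conjHom (tensorId (Φ.space L) (Φ.tensorMap L L))
  (tensorId (Φ.space L) (Φ.tensorMapInv L L))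
  (by rw [← tensorId_comp, tensorMap_comp_inv, tensorId_id])
  (by rw [← tensorId_comp, tensorMapInv_comp, tensorId_id])

/-- The representation of the automorphisms of `(L ⊗ L) ⊗ L` on the Hilbert space tensor
product. -/
def unitsTripleOperator : Aut ((L ⊗ L) ⊗ L) →*
    (HilbTensor (HilbTensor (Φ.space L) (Φ.space L)) (Φ.space L) →L[ℂ]
      HilbTensor (HilbTensor (Φ.space L) (Φ.space L)) (Φ.space L))ˣ :=
  (Units.map (Φ.tripleConj L)).comp (Φ.unitsTensorOperator (L ⊗ L) L)

theorem unitsTripleOperator_autLeg₁₂ (e : Aut (L ⊗ L)) :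
    Φ.unitsTripleOperator L (autLeg₁₂ L e)
      = leg₁₂ (Φ.space L) (Φ.unitsTensorOperator L L e) := by
  refine Units.ext ?_
  change (tensorId (Φ.space L) (Φ.tensorMapInv L L)).comp
      ((Φ.tensorOperator (e.hom ▷ L)).comp (tensorId (Φ.space L) (Φ.tensorMap L L)))
    = tensorId (Φ.space L) ((Φ.tensorMapInv L L).comp ((Φ.operator e.hom).comp (Φ.tensorMap L L)))
  rw [tensorOperator_whiskerRight, tensorId_comp, tensorId_comp]

/-- The operator `(For(L) ⊗ For(L)) ⊗ For(L) → For((L ⊗ L) ⊗ L)`. -/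
def tripleMap : HilbTensor (HilbTensor (Φ.space L) (Φ.space L)) (Φ.space L) →L[ℂ]
    Φ.space ((L ⊗ L) ⊗ L) :=
  (Φ.tensorMap (L ⊗ L) L).comp (tensorId (Φ.space L) (Φ.tensorMap L L))

/-- The inverse of `tripleMap`. -/
def tripleMapInv : Φ.space ((L ⊗ L) ⊗ L) →L[ℂ]
    HilbTensor (HilbTensor (Φ.space L) (Φ.space L)) (Φ.space L) :=
  (tensorId (Φ.space L) (Φ.tensorMapInv L L)).comp (Φ.tensorMapInv (L ⊗ L) L)

theorem tripleMapInv_tripleMap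
    (t : HilbTensor (HilbTensor (Φ.space L) (Φ.space L)) (Φ.space L)) :
    Φ.tripleMapInv L (Φ.tripleMap L t) = t := by
  have h : (tensorId (Φ.space L) (Φ.tensorMapInv L L)).comp
      (tensorId (Φ.space L) (Φ.tensorMap L L)) = ContinuousLinearMap.id ℂ _ := by
    rw [← tensorId_comp, tensorMapInv_comp, tensorId_id]
  exact (congrArg (tensorId (Φ.space L) (Φ.tensorMapInv L L))
    (Φ.tensorMapInv_tensorMap (L ⊗ L) L (tensorId (Φ.space L) (Φ.tensorMap L L) t))).trans
    (congrArg (fun f => f t) h)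

/-- The operator `For(L) ⊗ (For(L) ⊗ For(L)) → For(L ⊗ (L ⊗ L))`. -/
def tripleMap' : HilbTensor (Φ.space L) (HilbTensor (Φ.space L) (Φ.space L)) →L[ℂ]
    Φ.space (L ⊗ L ⊗ L) :=
  (Φ.tensorMap L (L ⊗ L)).comp (idTensor (Φ.space L) (Φ.tensorMap L L))

theorem operator_associator_tripleMap
    (t : HilbTensor (HilbTensor (Φ.space L) (Φ.space L)) (Φ.space L)) :
    Φ.operator (α_ L L L).hom (Φ.tripleMap L t)
      = Φ.tripleMap' L (HilbTensor.assoc _ _ _ t) := by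
  have h : (Φ.operator (α_ L L L).hom).comp (Φ.tripleMap L) = (Φ.tripleMap' L).comp
      (HilbTensor.assoc _ _ _).toContinuousLinearEquiv.toContinuousLinearMap := by
    refine HilbTensor.ext_clm₃ fun x y z => ?_
    calc Φ.operator (α_ L L L).hom (Φ.tensorMap (L ⊗ L) L
          (tensorId (Φ.space L) (Φ.tensorMap L L) (pureTensor (pureTensor x y) z)))
        = Φ.operator (α_ L L L).hom (Φ.tensorMap (L ⊗ L) L
          (pureTensor (Φ.tensorMap L L (pureTensor x y)) z)) := by rw [tensorId_pureTensor]
      _ = Φ.tensorMap L (L ⊗ L) (pureTensor x (Φ.tensorMap L L (pureTensor y z))) :=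
        Φ.associativity L L L x y z
      _ = Φ.tripleMap' L (pureTensor x (pureTensor y z)) :=
        congrArg (Φ.tensorMap L (L ⊗ L)) (idTensor_pureTensor _ _ _).symm
      _ = Φ.tripleMap' L (HilbTensor.assoc (Φ.space L) (Φ.space L) (Φ.space L)
          (pureTensor (pureTensor x y) z)) :=
        congrArg (Φ.tripleMap' L) (HilbTensor.assoc_pureTensor x y z).symm
  exact congrArg (fun f => f t) h

theorem operator_whiskerLeft_tripleMap' (f : L ⊗ L ⟶ L ⊗ L)
    (s : HilbTensor (Φ.space L) (HilbTensor (Φ.space L) (Φ.space L))) :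
    Φ.operator (L ◁ f) (Φ.tripleMap' L s)
      = Φ.tripleMap' L (idTensor (Φ.space L) (Φ.tensorOperator f) s) := by
  have h := Φ.tensorMap_natural (𝟙 L) f
  rw [id_tensorHom, operator_id, tensorId_id] at h
  have h1 : (Φ.operator f).comp (Φ.tensorMap L L)
      = (Φ.tensorMap L L).comp (Φ.tensorOperator f) :=
    ContinuousLinearMap.ext fun t => ((Φ.tensorIso L L).apply_symm_apply _).symm
  calc Φ.operator (L ◁ f) (Φ.tripleMap' L s)
      = ((Φ.operator (L ◁ f)).comp (Φ.tensorMap L (L ⊗ L)))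
          (idTensor (Φ.space L) (Φ.tensorMap L L) s) := rfl
    _ = Φ.tensorMap L (L ⊗ L) (((idTensor (Φ.space L) (Φ.operator f)).comp
          (idTensor (Φ.space L) (Φ.tensorMap L L))) s) := by rw [h]; rfl
    _ = Φ.tensorMap L (L ⊗ L) (((idTensor (Φ.space L) (Φ.tensorMap L L)).comp
          (idTensor (Φ.space L) (Φ.tensorOperator f))) s) := by
        rw [← idTensor_comp, ← idTensor_comp, h1]
    _ = _ := rfl

theorem unitsTripleOperator_autLeg₂₃ (e : Aut (L ⊗ L)) :
    Φ.unitsTripleOperator L (autLeg₂₃ L e)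
      = leg₂₃ (Φ.space L) (Φ.unitsTensorOperator L L e) := by
  refine Units.ext (ContinuousLinearMap.ext fun t => ?_)
  set s := lastTwo (Φ.space L) (Φ.space L) (Φ.space L) (Φ.tensorOperator e.hom) t with hs
  have h1 : Φ.operator (L ◁ e.hom) (Φ.operator (α_ L L L).hom (Φ.tripleMap L t))
      = Φ.operator (α_ L L L).hom (Φ.tripleMap L s) := by
    rw [operator_associator_tripleMap, operator_whiskerLeft_tripleMap',
      operator_associator_tripleMap, hs, lastTwo_apply, LinearIsometryEquiv.apply_symm_apply]
  have h2 : Φ.operator ((α_ L L L).hom ≫ L ◁ e.hom ≫ (α_ L L L).inv) (Φ.tripleMap L t)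
      = Φ.tripleMap L s := by
    calc _ = Φ.operator (α_ L L L).inv
          (Φ.operator (L ◁ e.hom) (Φ.operator (α_ L L L).hom (Φ.tripleMap L t))) := by
            rw [operator_comp, operator_comp]; rfl
      _ = ((Φ.operator (α_ L L L).inv).comp (Φ.operator (α_ L L L).hom)) (Φ.tripleMap L s) := by
            rw [h1]; rfl
      _ = _ := by rw [← operator_comp, Iso.hom_inv_id, operator_id]; rfl
  calc _ = Φ.tripleMapInv L
        (Φ.operator ((α_ L L L).hom ≫ L ◁ e.hom ≫ (α_ L L L).inv) (Φ.tripleMap L t)) := rfl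
    _ = Φ.tripleMapInv L (Φ.tripleMap L s) := congrArg (Φ.tripleMapInv L) h2
    _ = s := Φ.tripleMapInv_tripleMap L s

variable {L}

theorem isRegularPair [BraidedCategory C] (hc : IsRegularBraiding Φ) {F : L ⊗ L ⟶ L ⊗ L}
    (hF : IsMultiplicativeUnitary F) (hreg : IsRegularUnitary Φ F) :
    IsRegularPair (Φ.unitsTensorOperator L L (autBraid L))
      (Φ.unitsTensorOperator L L ((autBraid L)⁻¹ * hF.1.aut)) where
  star_braid := Φ.star_unitsTensorOperator (hc L L).1
  star_unitary := by
    rw [map_mul, StarMul.star_mul, map_inv, star_inv, Φ.star_unitsTensorOperator (e := autBraid L)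
      (hc L L).1, Φ.star_unitsTensorOperator (e := hF.1.aut) hF.1, mul_inv_rev]
  relations := hF.isBraidedPair.map_eq (Φ.unitsTripleOperator L)
    (Φ.unitsTripleOperator_autLeg₁₂ L _) (Φ.unitsTripleOperator_autLeg₂₃ L _)
    (Φ.unitsTripleOperator_autLeg₁₂ L _) (Φ.unitsTripleOperator_autLeg₂₃ L _)
  regular_braid := (hc L L).2
  regular_unitary := hreg

end FibreFunctor

end Concrete

/-! ### The zero Hilbert space, and the theorem -/

theorem isNondegenerateCStarSubalgebra_of_subsingleton {H : Type*} [NormedAddCommGroup H]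
    [InnerProductSpace ℂ H] [CompleteSpace H] [Subsingleton H] (A : Submodule ℂ (H →L[ℂ] H)) :
    IsNondegenerateCStarSubalgebra A where
  isClosed := Set.subsingleton_of_subsingleton.isClosed
  mul_mem a _ b _ := by rw [Subsingleton.elim (a * b) 0]; exact A.zero_mem
  star_mem a _ := by rw [Subsingleton.elim (star a) 0]; exact A.zero_mem
  nondegenerate := Subsingleton.elim _ _

theorem HilbTensor.subsingleton (V H : Type*) [NormedAddCommGroup H] [InnerProductSpace ℂ H]
    [NormedAddCommGroup V] [InnerProductSpace ℂ V] [Subsingleton V] :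
    Subsingleton (HilbTensor V H) := by
  have h : ContinuousLinearMap.id ℂ (HilbTensor V H) = 0 := HilbTensor.ext_clm fun v x => by
    rw [Subsingleton.elim v 0]
    exact congrArg (fun f => f x) (map_zero (leftTensor V H))
  exact subsingleton_of_forall_eq 0 fun t => congrArg (fun f => f t) h

end

theorem mainTheorem2 {C : Type u} [Category.{v} C] [CStarCategory C] [WStarCategory C]
    [MonoidalCategory C] [MonoidalWStarCategory C] [BraidedCategory C]
    (Φ : FibreFunctor.{u, v, w} C) (hc : IsRegularBraiding Φ)
    (L : C) (F : L ⊗ L ⟶ L ⊗ L) (hF : IsMultiplicativeUnitary F) (hreg : IsRegularUnitary Φ F) :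
    IsNondegenerateCStarSubalgebra (hatA Φ F) ∧
    IsNondegenerateCStarSubalgebra (hatA Φ (dualUnitary F)) ∧
    IsNondegenerateCStarSubalgebra (braidedTensor Φ (hatA Φ F) (hatA Φ (dualUnitary F))) ∧
    IsMultiplier (braidedTensor Φ (hatA Φ F) (hatA Φ (dualUnitary F))) (Φ.tensorOperator F) ∧
    closedSpan {T | ∃ a ∈ hatA Φ F, ∃ b ∈ hatA Φ (dualUnitary F),
        T = inclLeft Φ L L a * Φ.tensorOperator F * inclRight Φ L L b}
      = braidedTensor Φ (hatA Φ F) (hatA Φ (dualUnitary F)) := by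
  rcases subsingleton_or_nontrivial (Φ.space L) with h0 | h0
  · -- The results for nonzero Hilbert spaces rest on the existence of unit vectors.
    have := HilbTensor.subsingleton (Φ.space L) (Φ.space L)
    refine ⟨isNondegenerateCStarSubalgebra_of_subsingleton _,
      isNondegenerateCStarSubalgebra_of_subsingleton _,
      isNondegenerateCStarSubalgebra_of_subsingleton _, fun x hx => ?_, Subsingleton.elim _ _⟩
    have hy : ∀ y, y ∈ braidedTensor Φ (hatA Φ F) (hatA Φ (dualUnitary F)) := fun y =>
      Subsingleton.elim x y ▸ hx
    exact ⟨hy _, hy _⟩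
  have h := Φ.isRegularPair hc hF hreg
  set c := Φ.unitsTensorOperator L L (autBraid L) with hc'
  set g := Φ.unitsTensorOperator L L ((autBraid L)⁻¹ * hF.1.aut) with hg
  have h1 : (↑(c * g) : HilbTensor (Φ.space L) (Φ.space L) →L[ℂ] _) = Φ.tensorOperator F := by
    rw [hc', hg, ← map_mul, mul_inv_cancel_left]
    rfl
  have h2 : (↑(c⁻¹ * g⁻¹) : HilbTensor (Φ.space L) (Φ.space L) →L[ℂ] _)
      = Φ.tensorOperator (dualUnitary F) := by
    rw [hc', hg, ← map_inv, ← map_inv, ← map_mul, mul_inv_rev, inv_inv, ← mul_assoc,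
      Φ.coe_unitsTensorOperator]
    rfl
  have hA : sliceSpace (↑(c * g) : HilbTensor (Φ.space L) (Φ.space L) →L[ℂ] _) = hatA Φ F :=
    congrArg sliceSpace h1
  have hB : sliceSpace (↑(c⁻¹ * g⁻¹) : HilbTensor (Φ.space L) (Φ.space L) →L[ℂ] _)
      = hatA Φ (dualUnitary F) := congrArg sliceSpace h2
  have hAB : IsRegularPair.braidedAlgebra c g
      = braidedTensor Φ (hatA Φ F) (hatA Φ (dualUnitary F)) := by
    rw [← h.braidedAlgebra_eq, hA, hB]
    rfl
  rw [← hAB, ← h1, ← hA, ← hB]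
  exact ⟨h.isNondegenerateCStarSubalgebra, h.dual.isNondegenerateCStarSubalgebra,
    h.isNondegenerateCStarSubalgebra_braidedAlgebra, h.isMultiplier_braidedAlgebra,
    h.closedSpan_mul_unitary_mul⟩
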